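/- Let $M$ be a smooth real 4-manifold. An almost (para-)Hermitian structure $(g,K)$ on $M$ consists of a smooth non-degenerate symmetric complex-bilinear form $g$ on the fibres of $TM\otimes\mathbb{C}$ (for example the complex-bilinear extension of a real metric of any signature) and a smooth, possibly complex-valued, endomorphism $K$ of $TM\otimes\mathbb{C}$ such that $K^2=\mathbb{I}$, the eigenbundles of $K$ for the eigenvalues $\pm1$ have equal rank, and $g(KX,KY)=-g(X,Y)$ for all $X,Y$. (An almost Hermitian structure $J$ corresponds to $K=-iJ$.) The structure is half-integrable if at least one of the two eigenbundles is involutive under the Lie bracket, and integrable if its Nijenhuis tensor $$N_K(X,Y)=\tfrac14\big(K^2[X,Y]+[KX,KY]-K([KX,Y]+[X,KY])\big)$$ vanishes. Let $\mathbb{S},\mathbb{S}'$ be the (complex, rank 2) unprimed and primed spinor bundles of $(M,g)$, given by an open cover of $M$ with smooth local frames $e_{AA'}$ of $TM\otimes\mathbb{C}$ that satisfy $g(e_{AA'},e_{BB'})=\epsilon_{AB}\epsilon_{A'B'}$ and are related on overlaps by $SL(2,\mathbb{C})\times SL(2,\mathbb{C})$, acting separately on unprimed and primed indices; so locally $TM\otimes\mathbb{C}=\mathbb{S}\otimes\mathbb{S}'$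 and $g_{ab}=\epsilon_{AB}\epsilon_{A'B'}$, while $\mathbb{S}$ and $\mathbb{S}'$ need only be defined up to sign. Let $\nabla$ be the Levi-Civita connection of $g$ and the connection it induces on spinors. Suppose that $K$ has negative chirality, i.e. $K^a{}_b=\tau^A{}_B\,\delta^{A'}{}_{B'}$. A projective unprimed spinor field is a smooth field of lines in $\mathbb{S}$, i.e. an unprimed spinor field given locally by smooth nowhere vanishing representatives $\varphi^A$, defined up to $\varphi^A\to\lambda\varphi^A$. It represents $K$ if the vectors $\varphi^A\nu^{A'}$ form the $(+1)$-eigenbundle of $K$ at all points, or form the $(-1)$-eigenbundle of $K$ at all points. It is shear-free if its representatives satisfy $$\varphi^A\varphi^B\nabla_{AA'}\varphi_B=0,$$ a condition that is invariant under $\varphi^A\to\lambda\varphi^A$. Then: 1. $(g,K)$ is half-integrable if and only if there is a shear-free projective unprimed spinor field $\varphi^A$ that represents $K$. 2. $(g,K)$ is integrable if and only if there are two shear-free projective unprimed spinor fields that represent $K$ and are linearly independent at every point. -/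

import Mathlib

open scoped Manifold ContDiff TensorProduct

noncomputable section

namespace ParaHermitian

/-! ### Complexified tangent spaces, complex vector fields -/

/-- The model space of real 4-manifolds. -/
abbrev R4 : Type := EuclideanSpace ℝ (Fin 4)

section Fields

variable {M : Type*} [TopologicalSpace M] [ChartedSpace R4 M] [IsManifold 𝓘(ℝ, R4) ∞ M]

/-- The complexified tangent space `T_x M ⊗ ℂ`. -/
abbrev CTangent (x : M) : Type := ℂ ⊗[ℝ] TangentSpace 𝓘(ℝ, R4) x

/-- The real part `u` of a complex tangent vector `u + i v`. -/
def rePart (x : M) : CTangent x →ₗ[ℝ] TangentSpace 𝓘(ℝ, R4) x :=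
  (TensorProduct.lid ℝ (TangentSpace 𝓘(ℝ, R4) x)).toLinearMap ∘ₗ
    LinearMap.rTensor (TangentSpace 𝓘(ℝ, R4) x) Complex.reLm

/-- The imaginary part `v` of a complex tangent vector `u + i v`. -/
def imPart (x : M) : CTangent x →ₗ[ℝ] TangentSpace 𝓘(ℝ, R4) x :=
  (TensorProduct.lid ℝ (TangentSpace 𝓘(ℝ, R4) x)).toLinearMap ∘ₗ
    LinearMap.rTensor (TangentSpace 𝓘(ℝ, R4) x) Complex.imLm

variable (M) in
/-- (Not necessarily smooth) sections of `TM ⊗ ℂ`. A local section on an open set is represented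
by a field on `M` whose values outside that set are irrelevant. -/
abbrev CField : Type _ := ∀ x : M, CTangent x

/-- Smoothness of a complex vector field on a set. -/
def SmoothOn (X : CField M) (U : Set M) : Prop :=
  ContMDiffOn 𝓘(ℝ, R4) 𝓘(ℝ, R4).tangent ∞
      (fun x => (⟨x, rePart x (X x)⟩ : TangentBundle 𝓘(ℝ, R4) M)) U ∧
    ContMDiffOn 𝓘(ℝ, R4) 𝓘(ℝ, R4).tangent ∞
      (fun x => (⟨x, imPart x (X x)⟩ : TangentBundle 𝓘(ℝ, R4) M)) U

/-- The Lie bracket of vector fields, extended complex-bilinearly. -/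
def cLie (X Y : CField M) : CField M := fun x =>
  (1 : ℂ) ⊗ₜ[ℝ]
      (VectorField.mlieBracket 𝓘(ℝ, R4) (fun y => rePart y (X y)) (fun y => rePart y (Y y)) x -
        VectorField.mlieBracket 𝓘(ℝ, R4) (fun y => imPart y (X y)) (fun y => imPart y (Y y)) x) +
    Complex.I ⊗ₜ[ℝ]
      (VectorField.mlieBracket 𝓘(ℝ, R4) (fun y => rePart y (X y)) (fun y => imPart y (Y y)) x +
        VectorField.mlieBracket 𝓘(ℝ, R4) (fun y => imPart y (X y)) (fun y => rePart y (Y y)) x)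

/-- The derivative of a complex function along a real tangent vector. -/
def realDeriv (f : M → ℂ) (x : M) (v : TangentSpace 𝓘(ℝ, R4) x) : ℂ :=
  mfderiv 𝓘(ℝ, R4) 𝓘(ℝ, ℂ) f x v

/-- The derivative `X f` of a complex function along a complex vector field. -/
def cDeriv (X : CField M) (f : M → ℂ) (x : M) : ℂ :=
  realDeriv f x (rePart x (X x)) + Complex.I * realDeriv f x (imPart x (X x))

/-! ### Metrics and the Levi-Civita connection -/

variable (M) in
/-- A (complex) metric: a smooth non-degenerate symmetric bilinear form on the fibres of `TM ⊗ ℂ`.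
The complex-bilinear extension of a real metric of any signature is an instance. -/
structure CMetric where
  form : ∀ x : M, LinearMap.BilinForm ℂ (CTangent x)
  symm : ∀ x, (form x).IsSymm
  nondeg : ∀ x, (form x).Nondegenerate
  smooth : ∀ U : Set M, IsOpen U → ∀ X Y : CField M, SmoothOn X U → SmoothOn Y U →
    ContMDiffOn 𝓘(ℝ, R4) 𝓘(ℝ, ℂ) ∞ (fun x => form x (X x) (Y x)) U

/-- The right-hand side of the Koszul formula, i.e. `2 g(∇_X Y, Z)`. -/
def koszul (g : CMetric M) (X Y Z : CField M) (x : M) : ℂ :=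
  cDeriv X (fun y => g.form y (Y y) (Z y)) x + cDeriv Y (fun y => g.form y (X y) (Z y)) x
    - cDeriv Z (fun y => g.form y (X y) (Y y)) x
    + g.form x (cLie X Y x) (Z x) - g.form x (cLie X Z x) (Y x) - g.form x (cLie Y Z x) (X x)

/-- The coordinate basis of `T_x M ⊗ ℂ` for the preferred chart at `x`. -/
def coordBasis (x : M) : Module.Basis (Fin 4) ℂ (CTangent x) :=
  Module.Basis.baseChange ℂ
    ((EuclideanSpace.basisFun (Fin 4) ℝ).toBasis :
      Module.Basis (Fin 4) ℝ (TangentSpace 𝓘(ℝ, R4) x))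

/-- The coordinate vector fields of the preferred chart at `x`; they are smooth near `x`, and at
`x` itself they give the basis `coordBasis x`. -/
def coordField (x : M) (i : Fin 4) : CField M := fun y =>
  (1 : ℂ) ⊗ₜ[ℝ] (trivializationAt R4 (TangentSpace 𝓘(ℝ, R4) : M → Type) x).symm y
    (EuclideanSpace.basisFun (Fin 4) ℝ i)

/-- The Levi-Civita connection: `∇_X Y` at `x` is the vector `w` with
`2 g(w, ∂ᵢ) = koszul g X Y ∂ᵢ` for all coordinate fields `∂ᵢ` at `x`. -/
def leviCivita (g : CMetric M) (X Y : CField M) : CField M := fun x =>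
  ∑ i, ((1 / 2 : ℂ) * koszul g X Y (coordField x i) x) •
    (g.form x).dualBasis (g.nondeg x) (coordBasis x) i

end Fields

section Structures

variable {M : Type*} [TopologicalSpace M] [ChartedSpace R4 M] [IsManifold 𝓘(ℝ, R4) ∞ M]

/-! ### Almost (para-)Hermitian structures and their integrability -/

variable (M) in
/-- An almost (para-)Hermitian structure `(g, K)`: a para-Hermitian structure on `TM ⊗ ℂ`.
The map `K` may be complex-valued; `K = -i J` for an almost Hermitian structure `J`. -/
structure AlmostParaHermitian where
  g : CMetric M
  K : ∀ x : M, Module.End ℂ (CTangent x)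
  smooth : ∀ U : Set M, IsOpen U → ∀ X : CField M, SmoothOn X U →
    SmoothOn (fun x => K x (X x)) U
  sq : ∀ x, K x * K x = 1
  rank_eq : ∀ x, Module.finrank ℂ (Module.End.eigenspace (K x) 1) =
    Module.finrank ℂ (Module.End.eigenspace (K x) (-1))
  skew : ∀ x (u v : CTangent x), g.form x (K x u) (K x v) = -g.form x u v

/-- The bracket of two local sections of the distribution `L` is a section of `L`. -/
def Involutive (L : ∀ x : M, Submodule ℂ (CTangent x)) : Prop :=
  ∀ U : Set M, IsOpen U → ∀ X Y : CField M, SmoothOn X U → SmoothOn Y U →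
    (∀ x ∈ U, X x ∈ L x) → (∀ x ∈ U, Y x ∈ L x) → ∀ x ∈ U, cLie X Y x ∈ L x

namespace AlmostParaHermitian

variable (H : AlmostParaHermitian M)

/-- One of the two eigenbundles is involutive. -/
def HalfIntegrable : Prop :=
  Involutive (fun x => Module.End.eigenspace (H.K x) 1) ∨
    Involutive (fun x => Module.End.eigenspace (H.K x) (-1))

/-- The Nijenhuis tensor
`N_K(X,Y) = (1/4) (K²[X,Y] + [KX,KY] - K([KX,Y] + [X,KY]))`. -/
def nijenhuis (X Y : CField M) : CField M := fun x =>
  (1 / 4 : ℂ) •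
    (H.K x (H.K x (cLie X Y x)) + cLie (fun y => H.K y (X y)) (fun y => H.K y (Y y)) x
      - H.K x (cLie (fun y => H.K y (X y)) Y x + cLie X (fun y => H.K y (Y y)) x))

/-- The structure is integrable, i.e. a (para-)Hermitian structure, if `N_K = 0`. -/
def Integrable : Prop :=
  ∀ U : Set M, IsOpen U → ∀ X Y : CField M, SmoothOn X U → SmoothOn Y U →
    ∀ x ∈ U, H.nijenhuis X Y x = 0

end AlmostParaHermitian

/-! ### Spinors -/

/-- The symplectic form `ε_{AB}` (and `ε^{AB}`, `ε_{A'B'}`, `ε^{A'B'}`) in a spin frame: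
`ε_{01} = 1 = -ε_{10}`. -/
def eps (A B : Fin 2) : ℂ := !![0, 1; -1, 0] A B

/-- The vector `φ^A ν^{A'}` at `x`, for spinors given by components in the frame `e_{AA'}`. -/
def spinVec (e : Fin 2 → Fin 2 → CField M) (x : M) (φ ν : Fin 2 → ℂ) : CTangent x :=
  ∑ A, ∑ A', (φ A * ν A') • e A A' x

/-- The unprimed and primed spinor bundles of `(M, g)`, described by local spin frames:
an open cover of `M`; on each member `U_i` smooth complex vector fields `e_{AA'}` with
`g(e_{AA'}, e_{BB'}) = ε_{AB} ε_{A'B'}`, i.e. an identification `TM ⊗ ℂ = 𝕊 ⊗ 𝕊'` over `U_i` with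
`g_{ab} = ε_{AB} ε_{A'B'}`; and on overlaps a change of frame in `SL(2,ℂ) × SL(2,ℂ)`, acting
separately on unprimed and primed indices. -/
structure SpinStructure (g : CMetric M) (ι : Type*) where
  dom : ι → Set M
  isOpen : ∀ i, IsOpen (dom i)
  cover : ∀ x, ∃ i, x ∈ dom i
  frame : ι → Fin 2 → Fin 2 → CField M
  smooth : ∀ i A A', SmoothOn (frame i A A') (dom i)
  inner : ∀ i, ∀ x ∈ dom i, ∀ A A' B B',
    g.form x (frame i A A' x) (frame i B B' x) = eps A B * eps A' B'
  compat : ∀ i j, ∀ x ∈ dom i, x ∈ dom j → ∃ Λ Λ' : Matrix.SpecialLinearGroup (Fin 2) ℂ,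
    ∀ φ ν : Fin 2 → ℂ, spinVec (frame j) x φ ν =
      spinVec (frame i) x (Λ.1.mulVec φ) (Λ'.1.mulVec ν)

/-- Negative chirality: `K^a_b = τ^A_B δ^{A'}_{B'}`. -/
def NegativeChirality (H : AlmostParaHermitian M) {ι : Type*} (S : SpinStructure H.g ι) : Prop :=
  ∀ i, ∀ x ∈ S.dom i, ∃ τ : Matrix (Fin 2) (Fin 2) ℂ, ∀ φ ν : Fin 2 → ℂ,
    H.K x (spinVec (S.frame i) x φ ν) = spinVec (S.frame i) x (τ.mulVec φ) ν

/-- A projective unprimed spinor field: a smooth field of one-dimensional subspaces of the fibres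
of the unprimed spinor bundle, i.e. a spinor field that is locally given by smooth nowhere
vanishing representatives `φ^A`, defined up to rescaling `φ^A → λ φ^A`. -/
structure ProjSpinorField {g : CMetric M} {ι : Type*} (S : SpinStructure g ι) where
  /-- The line spanned by `φ^A`, in components in the `i`-th spin frame. -/
  line : ι → M → Submodule ℂ (Fin 2 → ℂ)
  locally_spanned : ∀ i, ∀ p ∈ S.dom i, ∃ V ⊆ S.dom i, IsOpen V ∧ p ∈ V ∧
    ∃ φ : M → Fin 2 → ℂ, ContMDiffOn 𝓘(ℝ, R4) 𝓘(ℝ, Fin 2 → ℂ) ∞ φ V ∧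
      ∀ x ∈ V, φ x ≠ 0 ∧ line i x = Submodule.span ℂ {φ x}
  compat : ∀ i j, ∀ x ∈ S.dom i, x ∈ S.dom j →
    ∀ Λ Λ' : Matrix.SpecialLinearGroup (Fin 2) ℂ,
      (∀ φ ν : Fin 2 → ℂ, spinVec (S.frame j) x φ ν =
        spinVec (S.frame i) x (Λ.1.mulVec φ) (Λ'.1.mulVec ν)) →
      line i x = (line j x).map Λ.1.mulVecLin

/-- The component `v^{AA'}` of a vector in the spin frame `e`:
`v^{AA'} = ε^{AB} ε^{A'B'} g(v, e_{BB'})`. -/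
def comp (g : CMetric M) (e : Fin 2 → Fin 2 → CField M) (x : M) (v : CTangent x)
    (A A' : Fin 2) : ℂ :=
  ∑ B, ∑ B', eps A B * eps A' B' * g.form x v (e B B' x)

/-- The unprimed spin connection coefficients `Γ_X{}^A{}_B` in the spin frame `e`. The Levi-Civita
connection satisfies `∇_X e_{BB'} = Γ_X{}^A{}_B e_{AB'} + Γ'_X{}^{A'}{}_{B'} e_{BA'}` with both
`Γ_X`, `Γ'_X` trace-free, hence `Γ_X{}^A{}_B = (1/2) ∑_{B'} (∇_X e_{BB'})^{AB'}`. -/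
def spinCoeff (g : CMetric M) (e : Fin 2 → Fin 2 → CField M) (X : CField M)
    (A B : Fin 2) (x : M) : ℂ :=
  (1 / 2 : ℂ) * ∑ B', comp g e x (leviCivita g X (e B B') x) A B'

/-- The covariant derivative `∇_{AA'} φ^B` of a local spinor field with components `φ^B`. -/
def spinDeriv (g : CMetric M) (e : Fin 2 → Fin 2 → CField M) (φ : M → Fin 2 → ℂ)
    (A A' B : Fin 2) (x : M) : ℂ :=
  cDeriv (e A A') (fun y => φ y B) x + ∑ C, spinCoeff g e (e A A') B C x * φ x C

/-- The shear-free equation `φ^A φ^B ∇_{AA'} φ_B = 0` on `V`, with `φ_B = φ^C ε_{CB}`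
(and `∇ ε = 0`). -/
def ShearFreeOn (g : CMetric M) (e : Fin 2 → Fin 2 → CField M) (φ : M → Fin 2 → ℂ)
    (V : Set M) : Prop :=
  ∀ x ∈ V, ∀ A', ∑ A, ∑ B, φ x A * φ x B * (∑ C, spinDeriv g e φ A A' C x * eps C B) = 0

/-- A projective spinor field is shear-free if its smooth local representatives are. -/
def ProjSpinorField.ShearFree {g : CMetric M} {ι : Type*} {S : SpinStructure g ι}
    (ℓ : ProjSpinorField S) : Prop :=
  ∀ i, ∀ V ⊆ S.dom i, IsOpen V → ∀ φ : M → Fin 2 → ℂ,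
    ContMDiffOn 𝓘(ℝ, R4) 𝓘(ℝ, Fin 2 → ℂ) ∞ φ V →
    (∀ x ∈ V, φ x ≠ 0 ∧ ℓ.line i x = Submodule.span ℂ {φ x}) →
    ShearFreeOn g (S.frame i) φ V

/-- `φ^A` is one of the two projective spinor fields representing `K`
(a principal spinor field of `K`): the vectors `φ^A ν^{A'}` form the `(+1)`-eigenbundle, or
they form the `(-1)`-eigenbundle. -/
def ProjSpinorField.Represents {H : AlmostParaHermitian M} {ι : Type*} {S : SpinStructure H.g ι}
    (ℓ : ProjSpinorField S) : Prop :=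
  ∃ s : ℂ, (s = 1 ∨ s = -1) ∧ ∀ i, ∀ x ∈ S.dom i, ∀ v : CTangent x,
    v ∈ Module.End.eigenspace (H.K x) s ↔
      ∃ φ ∈ ℓ.line i x, ∃ ν : Fin 2 → ℂ, v = spinVec (S.frame i) x φ ν

/-- Linear independence of two projective spinor fields: their representatives are linearly
independent at every point. -/
def ProjSpinorField.LinIndep {g : CMetric M} {ι : Type*} {S : SpinStructure g ι}
    (ℓ ℓ' : ProjSpinorField S) : Prop :=
  ∀ i, ∀ x ∈ S.dom i, Disjoint (ℓ.line i x) (ℓ'.line i x)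

end Structures

end ParaHermitian

end

/-!
# Shear-free spinors and the integrability of almost para-Hermitian structures

Let `φ` be a local spinor field without zeros and `V_{A'} = φ^A e_{AA'}`, for `A' = 0, 1`, the two
vector fields spanning the null planes `{φ^A ν^{A'}}`. Both parts of the theorem rest on the
identity `φ^A φ^B ∇_{AA'} φ_B = -g([V_0, V_1], V_{A'})` (`shear_eq_neg_form_cLie`). Indeed,
in a spin frame the metric has constant components, so the Koszul formula (`form_leviCivita_frame`, `koszul_frame`)
expresses the connection coefficients through the brackets `[e_a, e_b]`, while the Leibniz rule
expresses `[V_0, V_1]` through the same brackets and the derivatives of `φ`. What remains is a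
polynomial identity (`shear_identity`); the primed connection coefficients drop out because
`ε_{AB} φ^A φ^B = 0`.

A null plane `{φ^A ν^{A'}}` is its own orthogonal complement (`exists_eq_spinVec_iff_form`), so the
identity says that `φ` is shear-free exactly when `[V_0, V_1]` lies in the plane. By the Leibniz
rule and the smoothness of coefficients with respect to `V_0, V_1`, this is involutivity of
the field of planes (`ProjSpinorField.shearFree_iff_involutive`).

If `K^a_b = τ^A_B δ^{A'}_{B'}`, then `τ² = 1` and `det τ = -1`, so `τ` has the simple eigenvalues
`±1`, and the eigenbundle of `K` for `s = ±1` consists of the vectors `φ^A ν^{A'}` with `φ` in the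
eigenline of `τ` (`mem_eigenspace_iff_exists_eigenLine`). The columns of `τ + s` are smooth local
representatives of that line, which makes it a projective spinor field (`eigenSpinorField`). Hence
the `s`-eigenbundle of `K` is involutive if and only if the spinor field representing it is
shear-free. Finally `N_K = 0` if and only if both eigenbundles are involutive
(`AlmostParaHermitian.integrable_iff`), and two independent spinor fields that represent `K` must
belong to different eigenvalues (`not_disjoint_line_of_eigenspace`).
-/

noncomputable section

namespace ParaHermitian

section Calculus

variable {M : Type*} [TopologicalSpace M] [ChartedSpace R4 M]

/-! ### Real and imaginary parts -/

@[simp] lemma rePart_tmul (x : M) (z : ℂ) (v : TangentSpace 𝓘(ℝ, R4) x) :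
    rePart x (z ⊗ₜ[ℝ] v) = z.re • v := by
  simp [rePart]

@[simp] lemma imPart_tmul (x : M) (z : ℂ) (v : TangentSpace 𝓘(ℝ, R4) x) :
    imPart x (z ⊗ₜ[ℝ] v) = z.im • v := by
  simp [imPart]

lemma rePart_smul (x : M) (z : ℂ) (v : CTangent x) :
    rePart x (z • v) = z.re • rePart x v + (-z.im) • imPart x v := by
  induction v using TensorProduct.induction_on with
  | zero => simp
  | tmul w v =>
    simp only [TensorProduct.smul_tmul', rePart_tmul, imPart_tmul, smul_eq_mul, Complex.mul_re]
    module
  | add v w hv hw => simp only [smul_add, map_add, hv, hw]; module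

lemma imPart_smul (x : M) (z : ℂ) (v : CTangent x) :
    imPart x (z • v) = z.re • imPart x v + z.im • rePart x v := by
  induction v using TensorProduct.induction_on with
  | zero => simp
  | tmul w v =>
    simp only [TensorProduct.smul_tmul', rePart_tmul, imPart_tmul, smul_eq_mul, Complex.mul_im]
    module
  | add v w hv hw => simp only [smul_add, map_add, hv, hw]; module

lemma tmul_rePart_add_tmul_imPart (x : M) (v : CTangent x) :
    (1 : ℂ) ⊗ₜ[ℝ] rePart x v + Complex.I ⊗ₜ[ℝ] imPart x v = v := by
  induction v using TensorProduct.induction_on with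
  | zero => simp
  | tmul w v =>
    simp only [rePart_tmul, imPart_tmul, ← TensorProduct.smul_tmul]
    rw [← TensorProduct.add_tmul]
    congr 1
    apply Complex.ext <;> simp
  | add v w hv hw =>
    simp only [map_add, TensorProduct.tmul_add]
    nth_rewrite 3 [← hv]
    nth_rewrite 3 [← hw]
    abel

lemma CTangent.ext {x : M} {v w : CTangent x} (hre : rePart x v = rePart x w)
    (him : imPart x v = imPart x w) : v = w := by
  rw [← tmul_rePart_add_tmul_imPart x v, ← tmul_rePart_add_tmul_imPart x w, hre, him]

/-! ### Differentiation along complex vector fields -/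

variable {X Y Z : CField M} {U V : Set M} {f h : M → ℂ} {x : M}

lemma realDeriv_add (f : M → ℂ) (x : M) (u w : TangentSpace 𝓘(ℝ, R4) x) :
    realDeriv f x (u + w) = realDeriv f x u + realDeriv f x w :=
  (mfderiv 𝓘(ℝ, R4) 𝓘(ℝ, ℂ) f x).map_add u w

lemma realDeriv_smul (f : M → ℂ) (x : M) (r : ℝ) (u : TangentSpace 𝓘(ℝ, R4) x) :
    realDeriv f x (r • u) = (r : ℂ) * realDeriv f x u :=
  ((mfderiv 𝓘(ℝ, R4) 𝓘(ℝ, ℂ) f x).map_smul r u).trans Complex.real_smul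

/-- The complex-linear functional `v ↦ v f` on `T_x M ⊗ ℂ`. -/
def cDerivL (f : M → ℂ) (x : M) : CTangent x →ₗ[ℂ] ℂ where
  toFun v := realDeriv f x (rePart x v) + Complex.I * realDeriv f x (imPart x v)
  map_add' v w := by
    simp only [map_add, realDeriv_add]
    ring
  map_smul' z v := by
    simp only [rePart_smul, imPart_smul, realDeriv_add, realDeriv_smul,
      RingHom.id_apply, smul_eq_mul]
    nth_rewrite 5 [← Complex.re_add_im z]
    push_cast
    linear_combination (-(z.im : ℂ) * realDeriv f x (imPart x v)) * Complex.I_sq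

lemma cDeriv_eq_cDerivL (X : CField M) (f : M → ℂ) (x : M) :
    cDeriv X f x = cDerivL f x (X x) := rfl

lemma cDeriv_congr (h' : f =ᶠ[nhds x] h) : cDeriv X f x = cDeriv X h x := by
  simp only [cDeriv, realDeriv, h'.mfderiv_eq]
  rfl

@[simp] lemma cDeriv_const (c : ℂ) : cDeriv X (fun _ => c) x = 0 := by
  have h0 (v : TangentSpace 𝓘(ℝ, R4) x) : realDeriv (fun _ : M => c) x v = 0 := by
    simp only [realDeriv, mfderiv_const]
    rfl
  simp [cDeriv, h0]

lemma cDeriv_add (hf : MDifferentiableAt 𝓘(ℝ, R4) 𝓘(ℝ, ℂ) f x)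
    (hh : MDifferentiableAt 𝓘(ℝ, R4) 𝓘(ℝ, ℂ) h x) :
    cDeriv X (fun y => f y + h y) x = cDeriv X f x + cDeriv X h x := by
  have : ∀ v, realDeriv (fun y => f y + h y) x v = realDeriv f x v + realDeriv h x v := by
    intro v
    exact congrArg (fun L => L v) (mvfderiv_add hf hh)
  simp only [cDeriv, this]
  ring

lemma cDeriv_mul (hf : MDifferentiableAt 𝓘(ℝ, R4) 𝓘(ℝ, ℂ) f x)
    (hh : MDifferentiableAt 𝓘(ℝ, R4) 𝓘(ℝ, ℂ) h x) :
    cDeriv X (fun y => f y * h y) x = cDeriv X f x * h x + f x * cDeriv X h x := by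
  have : ∀ v, realDeriv (fun y => f y * h y) x v =
      realDeriv f x v * h x + f x * realDeriv h x v := by
    intro v
    have := congrArg (fun L => L v) (hf.hasMFDerivAt.mul' hh.hasMFDerivAt).mfderiv
    rw [add_comm]
    exact this
  simp only [cDeriv, this]
  ring

/-! ### The complex Lie bracket -/

lemma cLie_congr {X' Y' : CField M} (hX : ∀ᶠ y in nhds x, X y = X' y)
    (hY : ∀ᶠ y in nhds x, Y y = Y' y) :
    cLie X Y x = cLie X' Y' x := by
  have h1 : (fun y => rePart y (X y)) =ᶠ[nhds x] fun y => rePart y (X' y) :=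
    hX.mono fun y hy => congrArg (rePart y) hy
  have h2 : (fun y => imPart y (X y)) =ᶠ[nhds x] fun y => imPart y (X' y) :=
    hX.mono fun y hy => congrArg (imPart y) hy
  have h3 : (fun y => rePart y (Y y)) =ᶠ[nhds x] fun y => rePart y (Y' y) :=
    hY.mono fun y hy => congrArg (rePart y) hy
  have h4 : (fun y => imPart y (Y y)) =ᶠ[nhds x] fun y => imPart y (Y' y) :=
    hY.mono fun y hy => congrArg (imPart y) hy
  simp only [cLie, h1.mlieBracket_vectorField_eq h3, h1.mlieBracket_vectorField_eq h4,
    h2.mlieBracket_vectorField_eq h3, h2.mlieBracket_vectorField_eq h4]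

lemma rePart_cLie : rePart x (cLie X Y x) =
    VectorField.mlieBracket 𝓘(ℝ, R4) (fun y => rePart y (X y)) (fun y => rePart y (Y y)) x -
    VectorField.mlieBracket 𝓘(ℝ, R4) (fun y => imPart y (X y)) (fun y => imPart y (Y y)) x := by
  simp [cLie]

lemma imPart_cLie : imPart x (cLie X Y x) =
    VectorField.mlieBracket 𝓘(ℝ, R4) (fun y => rePart y (X y)) (fun y => imPart y (Y y)) x +
    VectorField.mlieBracket 𝓘(ℝ, R4) (fun y => imPart y (X y)) (fun y => rePart y (Y y)) x := by
  simp [cLie]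

lemma cLie_swap : cLie X Y x = -cLie Y X x := by
  apply CTangent.ext
  · rw [map_neg, rePart_cLie, rePart_cLie, VectorField.mlieBracket_swap_apply,
      VectorField.mlieBracket_swap_apply (V := fun y => imPart y (X y))]
    abel
  · rw [map_neg, imPart_cLie, imPart_cLie, VectorField.mlieBracket_swap_apply,
      VectorField.mlieBracket_swap_apply (V := fun y => imPart y (X y))]
    abel

/-! ### Smooth complex vector fields -/

lemma contMDiffOn_re (hf : ContMDiffOn 𝓘(ℝ, R4) 𝓘(ℝ, ℂ) ∞ f U) :
    ContMDiffOn 𝓘(ℝ, R4) 𝓘(ℝ, ℝ) ∞ (fun x => (f x).re) U :=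
  Complex.reCLM.contDiff.contMDiff.comp_contMDiffOn hf

lemma contMDiffOn_im (hf : ContMDiffOn 𝓘(ℝ, R4) 𝓘(ℝ, ℂ) ∞ f U) :
    ContMDiffOn 𝓘(ℝ, R4) 𝓘(ℝ, ℝ) ∞ (fun x => (f x).im) U :=
  Complex.imCLM.contDiff.contMDiff.comp_contMDiffOn hf

lemma contMDiffOn_mul (hf : ContMDiffOn 𝓘(ℝ, R4) 𝓘(ℝ, ℂ) ∞ f U)
    (hh : ContMDiffOn 𝓘(ℝ, R4) 𝓘(ℝ, ℂ) ∞ h U) :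
    ContMDiffOn 𝓘(ℝ, R4) 𝓘(ℝ, ℂ) ∞ (fun x => f x * h x) U :=
  (contDiff_mul (𝕜 := ℝ) (𝔸 := ℂ)).contMDiff.comp_contMDiffOn (hf.prodMk_space hh)

lemma contMDiffOn_inv (hf : ContMDiffOn 𝓘(ℝ, R4) 𝓘(ℝ, ℂ) ∞ f U)
    (h0 : ∀ x ∈ U, f x ≠ 0) : ContMDiffOn 𝓘(ℝ, R4) 𝓘(ℝ, ℂ) ∞ (fun x => (f x)⁻¹) U :=
  fun x hx => (contDiffAt_inv ℝ (h0 x hx)).contMDiffAt.comp_contMDiffWithinAt x (hf x hx)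

variable [IsManifold 𝓘(ℝ, R4) ∞ M]

/-- Differentiability at a point of a complex vector field. -/
def DiffAt (X : CField M) (x : M) : Prop :=
  MDifferentiableAt 𝓘(ℝ, R4) 𝓘(ℝ, R4).tangent
      (fun y => (⟨y, rePart y (X y)⟩ : TangentBundle 𝓘(ℝ, R4) M)) x ∧
    MDifferentiableAt 𝓘(ℝ, R4) 𝓘(ℝ, R4).tangent
      (fun y => (⟨y, imPart y (X y)⟩ : TangentBundle 𝓘(ℝ, R4) M)) x

lemma SmoothOn.diffAt (hX : SmoothOn X U) (hU : IsOpen U) (hx : x ∈ U) : DiffAt X x :=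
  ⟨(hX.1.contMDiffAt (hU.mem_nhds hx)).mdifferentiableAt (by simp),
    (hX.2.contMDiffAt (hU.mem_nhds hx)).mdifferentiableAt (by simp)⟩

lemma SmoothOn.mono (hX : SmoothOn X U) (hV : V ⊆ U) : SmoothOn X V :=
  ⟨hX.1.mono hV, hX.2.mono hV⟩

lemma SmoothOn.add (hX : SmoothOn X U) (hY : SmoothOn Y U) :
    SmoothOn (fun x => X x + Y x) U := by
  constructor
  · simp only [map_add]
    exact hX.1.add_section hY.1
  · simp only [map_add]
    exact hX.2.add_section hY.2

lemma SmoothOn.smul (hf : ContMDiffOn 𝓘(ℝ, R4) 𝓘(ℝ, ℂ) ∞ f U) (hX : SmoothOn X U) :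
    SmoothOn (fun x => f x • X x) U := by
  constructor
  · simp only [rePart_smul]
    exact ((contMDiffOn_re hf).smul_section hX.1).add_section
      (((contMDiffOn_im hf).neg).smul_section hX.2)
  · simp only [imPart_smul]
    exact ((contMDiffOn_re hf).smul_section hX.2).add_section
      ((contMDiffOn_im hf).smul_section hX.1)

lemma SmoothOn.const_smul (c : ℂ) (hX : SmoothOn X U) : SmoothOn (fun x => c • X x) U :=
  SmoothOn.smul contMDiffOn_const hX

lemma SmoothOn.sum {α : Type*} {s : Finset α} {X : α → CField M}
    (hX : ∀ a ∈ s, SmoothOn (X a) U) : SmoothOn (fun x => ∑ a ∈ s, X a x) U := by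
  constructor
  · simp only [map_sum]
    exact ContMDiffOn.sum_section fun a ha => (hX a ha).1
  · simp only [map_sum]
    exact ContMDiffOn.sum_section fun a ha => (hX a ha).2

/-! ### The Leibniz rule for the complex Lie bracket -/

lemma cLie_add_right (hY : DiffAt Y x) (hZ : DiffAt Z x) :
    cLie X (fun y => Y y + Z y) x = cLie X Y x + cLie X Z x := by
  have hre (W : ∀ x : M, TangentSpace 𝓘(ℝ, R4) x) :=
    VectorField.mlieBracket_add_right (V := W) hY.1 hZ.1
  have him (W : ∀ x : M, TangentSpace 𝓘(ℝ, R4) x) :=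
    VectorField.mlieBracket_add_right (V := W) hY.2 hZ.2
  have e1 : (fun y => rePart y (Y y + Z y)) =
    (fun y => rePart y (Y y)) + (fun y => rePart y (Z y)) := by ext1 y; simp
  have e2 : (fun y => imPart y (Y y + Z y)) =
    (fun y => imPart y (Y y)) + (fun y => imPart y (Z y)) := by ext1 y; simp
  apply CTangent.ext
  · rw [map_add, rePart_cLie, rePart_cLie, rePart_cLie, e1, e2, hre, him]
    abel
  · rw [map_add, imPart_cLie, imPart_cLie, imPart_cLie, e1, e2, hre, him]
    abel

lemma cLie_add_left (hY : DiffAt Y x) (hZ : DiffAt Z x) :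
    cLie (fun y => Y y + Z y) X x = cLie Y X x + cLie Z X x := by
  rw [cLie_swap, cLie_add_right hY hZ, cLie_swap, cLie_swap (X := X) (Y := Z)]
  abel

lemma mlieBracket_smul_add_smul_right {W A B : ∀ x : M, TangentSpace 𝓘(ℝ, R4) x} {a b : M → ℝ}
    (ha : MDifferentiableAt 𝓘(ℝ, R4) 𝓘(ℝ, ℝ) a x)
    (hb : MDifferentiableAt 𝓘(ℝ, R4) 𝓘(ℝ, ℝ) b x)
    (hA : MDifferentiableAt 𝓘(ℝ, R4) 𝓘(ℝ, R4).tangent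
      (fun y => (⟨y, A y⟩ : TangentBundle 𝓘(ℝ, R4) M)) x)
    (hB : MDifferentiableAt 𝓘(ℝ, R4) 𝓘(ℝ, R4).tangent
      (fun y => (⟨y, B y⟩ : TangentBundle 𝓘(ℝ, R4) M)) x) :
    VectorField.mlieBracket 𝓘(ℝ, R4) W (fun y => a y • A y + b y • B y) x =
      (mvfderiv 𝓘(ℝ, R4) a x (W x) • A x + a x • VectorField.mlieBracket 𝓘(ℝ, R4) W A x) +
      (mvfderiv 𝓘(ℝ, R4) b x (W x) • B x + b x • VectorField.mlieBracket 𝓘(ℝ, R4) W B x) := by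
  rw [← VectorField.mlieBracket_smul_right ha hA, ← VectorField.mlieBracket_smul_right hb hB]
  exact VectorField.mlieBracket_add_right (ha.smul_section hA) (hb.smul_section hB)

/-- The Leibniz rule in the second argument, from the real one for real and imaginary parts. -/
lemma cLie_smul_right (hf : MDifferentiableAt 𝓘(ℝ, R4) 𝓘(ℝ, ℂ) f x) (hY : DiffAt Y x) :
    cLie X (fun y => f y • Y y) x = cDeriv X f x • Y x + f x • cLie X Y x := by
  have hreL : HasMFDerivAt 𝓘(ℝ, ℂ) 𝓘(ℝ, ℝ) (fun z : ℂ => z.re) (f x) Complex.reCLM :=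
    Complex.reCLM.hasMFDerivAt
  have himL : HasMFDerivAt 𝓘(ℝ, ℂ) 𝓘(ℝ, ℝ) (fun z : ℂ => z.im) (f x) Complex.imCLM :=
    Complex.imCLM.hasMFDerivAt
  have hre := hreL.comp x hf.hasMFDerivAt
  have him := himL.comp x hf.hasMFDerivAt
  have dre (v : TangentSpace 𝓘(ℝ, R4) x) :
      mvfderiv 𝓘(ℝ, R4) (fun y => (f y).re) x v = (realDeriv f x v).re :=
    congrArg (fun L => L v) hre.mfderiv
  have dim (v : TangentSpace 𝓘(ℝ, R4) x) :
      mvfderiv 𝓘(ℝ, R4) (fun y => (f y).im) x v = (realDeriv f x v).im :=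
    congrArg (fun L => L v) him.mfderiv
  have dimn (v : TangentSpace 𝓘(ℝ, R4) x) :
      mvfderiv 𝓘(ℝ, R4) (fun y => -(f y).im) x v = -(realDeriv f x v).im :=
    congrArg (fun L => L v) him.neg.mfderiv
  have h1 (W : ∀ x : M, TangentSpace 𝓘(ℝ, R4) x) :=
    mlieBracket_smul_add_smul_right (W := W) hre.mdifferentiableAt
      him.neg.mdifferentiableAt hY.1 hY.2
  have h2 (W : ∀ x : M, TangentSpace 𝓘(ℝ, R4) x) :=
    mlieBracket_smul_add_smul_right (W := W) hre.mdifferentiableAt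
      him.mdifferentiableAt hY.2 hY.1
  have e1 (W : ∀ x : M, TangentSpace 𝓘(ℝ, R4) x) :
      VectorField.mlieBracket 𝓘(ℝ, R4) W
        (fun y => (f y).re • rePart y (Y y) + (-(f y).im) • imPart y (Y y)) x = _ := h1 W
  have e2 (W : ∀ x : M, TangentSpace 𝓘(ℝ, R4) x) :
      VectorField.mlieBracket 𝓘(ℝ, R4) W
        (fun y => (f y).re • imPart y (Y y) + (f y).im • rePart y (Y y)) x = _ := h2 W
  apply CTangent.ext
  · rw [rePart_cLie]
    simp only [rePart_smul, imPart_smul, map_add]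
    rw [e1, e2]
    simp only [Function.comp_def, Pi.neg_apply]
    erw [dre, dimn, dre, dim]
    simp only [rePart_cLie, imPart_cLie, cDeriv, Complex.add_re, Complex.add_im, Complex.mul_re,
      Complex.mul_im, Complex.I_re, Complex.I_im]
    module
  · rw [imPart_cLie]
    simp only [rePart_smul, imPart_smul, map_add]
    rw [e1, e2]
    simp only [Function.comp_def, Pi.neg_apply]
    erw [dre, dimn, dre, dim]
    simp only [rePart_cLie, imPart_cLie, cDeriv, Complex.add_re, Complex.add_im, Complex.mul_re,
      Complex.mul_im, Complex.I_re, Complex.I_im]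
    module

lemma cLie_smul_left (hf : MDifferentiableAt 𝓘(ℝ, R4) 𝓘(ℝ, ℂ) f x) (hX : DiffAt X x) :
    cLie (fun y => f y • X y) Y x = -(cDeriv Y f x • X x) + f x • cLie X Y x := by
  rw [cLie_swap, cLie_smul_right hf hX, cLie_swap (X := Y)]
  module

end Calculus

section Frames

variable {M : Type*} [TopologicalSpace M] [ChartedSpace R4 M]

/-! ### Spin frames -/

lemma finrank_cTangent (x : M) : Module.finrank ℂ (CTangent x) = 4 := by
  simpa using Module.finrank_eq_card_basis (coordBasis x)

/-- The complex vector field `φ^A e_{AA'}`. -/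
def spinField (e : Fin 2 → Fin 2 → CField M) (φ : M → Fin 2 → ℂ) (A' : Fin 2) : CField M :=
  fun x => ∑ A, φ x A • e A A' x

lemma spinVec_eq_sum_spinField (e : Fin 2 → Fin 2 → CField M) (x : M)
    (φ : M → Fin 2 → ℂ) (ν : Fin 2 → ℂ) :
    spinVec e x (φ x) ν = ∑ A', ν A' • spinField e φ A' x := by
  simp only [spinVec, spinField, Fin.sum_univ_two]
  module

variable [IsManifold 𝓘(ℝ, R4) ∞ M]

/-- Smooth complex vector fields `e_{AA'}` on the open set `U` with
`g(e_{AA'}, e_{BB'}) = ε_{AB} ε_{A'B'}`. -/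
structure IsSpinFrame (g : CMetric M) (e : Fin 2 → Fin 2 → CField M) (U : Set M) : Prop where
  isOpen : IsOpen U
  smooth : ∀ A A', SmoothOn (e A A') U
  inner : ∀ x ∈ U, ∀ A A' B B', g.form x (e A A' x) (e B B' x) = eps A B * eps A' B'

lemma SpinStructure.isSpinFrame {g : CMetric M} {ι : Type*} (S : SpinStructure g ι) (i : ι) :
    IsSpinFrame g (S.frame i) (S.dom i) :=
  ⟨S.isOpen i, S.smooth i, S.inner i⟩

variable {g : CMetric M} {e : Fin 2 → Fin 2 → CField M} {U V : Set M} {x : M}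

lemma IsSpinFrame.mono (he : IsSpinFrame g e U) (hV : IsOpen V) (hVU : V ⊆ U) :
    IsSpinFrame g e V :=
  ⟨hV, fun A A' => (he.smooth A A').mono hVU, fun x hx => he.inner x (hVU hx)⟩

lemma comp_add (v w : CTangent x) (A A' : Fin 2) :
    comp g e x (v + w) A A' = comp g e x v A A' + comp g e x w A A' := by
  simp only [comp, map_add, LinearMap.add_apply, mul_add, Finset.sum_add_distrib]

lemma comp_smul (z : ℂ) (v : CTangent x) (A A' : Fin 2) :
    comp g e x (z • v) A A' = z * comp g e x v A A' := by
  simp only [comp, map_smul, LinearMap.smul_apply, smul_eq_mul, Finset.mul_sum]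
  refine Finset.sum_congr rfl fun B _ => Finset.sum_congr rfl fun B' _ => by ring

lemma comp_sum_smul (he : IsSpinFrame g e U) (hx : x ∈ U) (c : Fin 2 → Fin 2 → ℂ)
    (A A' : Fin 2) : comp g e x (∑ B, ∑ B', c B B' • e B B' x) A A' = c A A' := by
  simp only [comp, map_sum, map_smul, LinearMap.sum_apply, LinearMap.smul_apply, he.inner x hx]
  fin_cases A <;> fin_cases A' <;> simp [Fin.sum_univ_two, eps]

lemma comp_spinVec (he : IsSpinFrame g e U) (hx : x ∈ U) (φ ν : Fin 2 → ℂ) (A A' : Fin 2) :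
    comp g e x (spinVec e x φ ν) A A' = φ A * ν A' :=
  comp_sum_smul he hx (fun A A' => φ A * ν A') A A'

/-- A spin frame is a basis: it is linearly independent because its Gram matrix is invertible. -/
lemma eq_sum_comp_smul (he : IsSpinFrame g e U) (hx : x ∈ U) (v : CTangent x) :
    v = ∑ A, ∑ A', comp g e x v A A' • e A A' x := by
  have hli : LinearIndependent ℂ (fun a : Fin 2 × Fin 2 => e a.1 a.2 x) := by
    rw [Fintype.linearIndependent_iff]
    intro c hc a
    rw [Fintype.sum_prod_type] at hc
    have := comp_sum_smul he hx (fun A A' => c (A, A')) a.1 a.2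
    rw [hc] at this
    simpa [comp] using this.symm
  have : FiniteDimensional ℂ (CTangent x) := Module.Finite.of_basis (coordBasis x)
  have htop := hli.span_eq_top_of_card_eq_finrank' (by
    rw [finrank_cTangent, Fintype.card_prod, Fintype.card_fin])
  obtain ⟨c, hc⟩ : ∃ c : Fin 2 × Fin 2 → ℂ, ∑ a, c a • e a.1 a.2 x = v := by
    rw [← Submodule.mem_span_range_iff_exists_fun, htop]
    trivial
  rw [Fintype.sum_prod_type] at hc
  have := comp_sum_smul he hx (fun A A' => c (A, A'))
  rw [hc] at this
  simp only [this]
  exact hc.symm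

lemma contMDiffOn_comp (he : IsSpinFrame g e U) {X : CField M} (hX : SmoothOn X U)
    (A A' : Fin 2) :
    ContMDiffOn 𝓘(ℝ, R4) 𝓘(ℝ, ℂ) ∞ (fun x => comp g e x (X x) A A') U := by
  simp only [comp, Fin.sum_univ_two]
  have h (B B' : Fin 2) := g.smooth U he.isOpen X (e B B') hX (he.smooth B B')
  have hc (B B' : Fin 2) : ContMDiffOn 𝓘(ℝ, R4) 𝓘(ℝ, ℂ) ∞
      (fun x => eps A B * eps A' B' * g.form x (X x) (e B B' x)) U :=
    contMDiffOn_mul contMDiffOn_const (h B B')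
  exact ((hc 0 0).add (hc 0 1)).add ((hc 1 0).add (hc 1 1))

/-! ### The Levi-Civita connection in a spin frame -/

lemma CMetric.mdifferentiableAt (g : CMetric M) {X Y : CField M} (hU : IsOpen U) (hx : x ∈ U)
    (hX : SmoothOn X U) (hY : SmoothOn Y U) :
    MDifferentiableAt 𝓘(ℝ, R4) 𝓘(ℝ, ℂ) (fun y => g.form y (X y) (Y y)) x :=
  ((g.smooth U hU X Y hX hY).contMDiffAt (hU.mem_nhds hx)).mdifferentiableAt (by simp)

variable {X Y Z W : CField M} {f : M → ℂ}

lemma koszul_congr_right {Z' : CField M} (h : ∀ᶠ y in nhds x, Z y = Z' y) :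
    koszul g X Y Z x = koszul g X Y Z' x := by
  have hx : Z x = Z' x := h.self_of_nhds
  have h1 (X : CField M) : cLie X Z x = cLie X Z' x := cLie_congr (.of_forall fun _ => rfl) h
  have h2 (X Y : CField M) : cDeriv X (fun y => g.form y (Y y) (Z y)) x =
      cDeriv X (fun y => g.form y (Y y) (Z' y)) x :=
    cDeriv_congr (h.mono fun y hy => congrArg (g.form y (Y y)) hy)
  simp only [koszul, h1, h2, cDeriv_eq_cDerivL, hx]

lemma koszul_add_right (hU : IsOpen U) (hx : x ∈ U) (hX : SmoothOn X U) (hY : SmoothOn Y U)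
    (hZ : SmoothOn Z U) (hW : SmoothOn W U) :
    koszul g X Y (fun y => Z y + W y) x = koszul g X Y Z x + koszul g X Y W x := by
  simp only [koszul, map_add, LinearMap.add_apply, cLie_add_right (hZ.diffAt hU hx)
    (hW.diffAt hU hx)]
  rw [cDeriv_add (g.mdifferentiableAt hU hx hY hZ) (g.mdifferentiableAt hU hx hY hW),
    cDeriv_add (g.mdifferentiableAt hU hx hX hZ) (g.mdifferentiableAt hU hx hX hW)]
  simp only [cDeriv_eq_cDerivL, map_add]
  ring

lemma koszul_smul_right (hU : IsOpen U) (hx : x ∈ U) (hX : SmoothOn X U) (hY : SmoothOn Y U)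
    (hZ : SmoothOn Z U) (hf : MDifferentiableAt 𝓘(ℝ, R4) 𝓘(ℝ, ℂ) f x) :
    koszul g X Y (fun y => f y • Z y) x = f x * koszul g X Y Z x := by
  simp only [koszul, map_add, map_smul, LinearMap.add_apply, LinearMap.smul_apply, smul_eq_mul,
    cLie_smul_right hf (hZ.diffAt hU hx)]
  rw [cDeriv_mul hf (g.mdifferentiableAt hU hx hY hZ),
    cDeriv_mul hf (g.mdifferentiableAt hU hx hX hZ), (g.symm x).eq (Z x) (X x),
    (g.symm x).eq (Z x) (Y x)]
  simp only [cDeriv_eq_cDerivL, map_smul, smul_eq_mul]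
  ring

lemma koszul_sum_smul_right {α : Type*} (s : Finset α) {f : α → M → ℂ} {Z : α → CField M}
    (hU : IsOpen U) (hx : x ∈ U) (hX : SmoothOn X U) (hY : SmoothOn Y U)
    (hf : ∀ a, ContMDiffOn 𝓘(ℝ, R4) 𝓘(ℝ, ℂ) ∞ (f a) U) (hZ : ∀ a, SmoothOn (Z a) U) :
    koszul g X Y (fun y => ∑ a ∈ s, f a y • Z a y) x =
      ∑ a ∈ s, f a x * koszul g X Y (Z a) x := by
  classical
  induction s using Finset.induction_on with
  | empty =>
    have hz (X : CField M) : cLie X (fun y => (0 : CTangent y)) x = 0 := by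
      apply CTangent.ext
      · simp only [rePart_cLie, map_zero]
        erw [VectorField.mlieBracket_zero_right, VectorField.mlieBracket_zero_right]
        simp
      · simp only [imPart_cLie, map_zero]
        erw [VectorField.mlieBracket_zero_right, VectorField.mlieBracket_zero_right]
        simp
    simp [koszul, hz, cDeriv_eq_cDerivL (fun y => (0 : CTangent y))]
  | insert a s ha ih =>
    simp only [Finset.sum_insert ha, ← ih]
    rw [koszul_add_right hU hx hX hY (SmoothOn.smul (hf a) (hZ a))
      (SmoothOn.sum fun b _ => SmoothOn.smul (hf b) (hZ b)),
      koszul_smul_right hU hx hX hY (hZ a)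
        (((hf a).contMDiffAt (hU.mem_nhds hx)).mdifferentiableAt (by simp))]

lemma smoothOn_coordField (x : M) (i : Fin 4) : SmoothOn (coordField x i)
    (trivializationAt R4 (TangentSpace 𝓘(ℝ, R4) : M → Type) x).baseSet := by
  constructor
  · refine (Bundle.Trivialization.contMDiffOn_section_baseSet_iff _).mpr ?_
    refine (contMDiffOn_const (c := EuclideanSpace.basisFun (Fin 4) ℝ i)).congr fun y hy => ?_
    simp only [coordField, rePart_tmul, Complex.one_re, one_smul]
    exact congrArg Prod.snd (Bundle.Trivialization.apply_mk_symm _ hy _)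
  · refine (Bundle.Trivialization.contMDiffOn_section_baseSet_iff _).mpr ?_
    refine (contMDiffOn_const (c := (0 : R4))).congr fun y hy => ?_
    simp only [coordField, imPart_tmul, Complex.one_im, zero_smul]
    exact congrArg Prod.snd (Bundle.Trivialization.zeroSection ℝ _ hy)

lemma coordField_self (x : M) (i : Fin 4) : coordField x i x = coordBasis x i := by
  have h : (trivializationAt R4 (TangentSpace 𝓘(ℝ, R4) : M → Type) x).symm x
      (EuclideanSpace.basisFun (Fin 4) ℝ i) = EuclideanSpace.basisFun (Fin 4) ℝ i := by
    have := congrArg (fun L => L (EuclideanSpace.basisFun (Fin 4) ℝ i))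
      (TangentBundle.symmL_trivializationAt_eq_core (I := 𝓘(ℝ, R4)) (mem_chart_source R4 x))
    refine (Bundle.Trivialization.symmL_apply _
      (FiberBundle.mem_baseSet_trivializationAt' x) _).symm.trans (this.trans ?_)
    exact (tangentBundleCore 𝓘(ℝ, R4) M).coordChange_self (achart R4 x) x
      (mem_chart_source R4 x) _
  have hb : coordBasis x i = (1 : ℂ) ⊗ₜ[ℝ] (show TangentSpace 𝓘(ℝ, R4) x from
      EuclideanSpace.basisFun (Fin 4) ℝ i) := by
    refine (Module.Basis.baseChange_apply ..).trans ?_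
    exact congrArg (fun v : TangentSpace 𝓘(ℝ, R4) x => (1 : ℂ) ⊗ₜ[ℝ] v)
      (congrFun (EuclideanSpace.basisFun (Fin 4) ℝ).coe_toBasis i)
  rw [hb]
  exact congrArg (fun v : TangentSpace 𝓘(ℝ, R4) x => (1 : ℂ) ⊗ₜ[ℝ] v) h

lemma form_leviCivita_coordBasis (i : Fin 4) :
    g.form x (leviCivita g X Y x) (coordBasis x i) =
      (1 / 2 : ℂ) * koszul g X Y (coordField x i) x := by
  simp [leviCivita, LinearMap.BilinForm.apply_dualBasis_left]

/-- Koszul's expression at `x` for a field `Z` that is smooth near `x`, by tensoriality in `Z`. -/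
lemma koszul_eq_sum_comp (he : IsSpinFrame g e U) (hx : x ∈ U) (hX : SmoothOn X U)
    (hY : SmoothOn Y U) (hV : IsOpen V) (hxV : x ∈ V) (hZ : SmoothOn Z V) :
    koszul g X Y Z x = ∑ A, ∑ A', comp g e x (Z x) A A' * koszul g X Y (e A A') x := by
  have hUV : IsOpen (U ∩ V) := he.isOpen.inter hV
  have heV := he.mono hUV Set.inter_subset_left
  have hZV : SmoothOn Z (U ∩ V) := hZ.mono Set.inter_subset_right
  obtain ⟨c, hc⟩ : ∃ c : Fin 2 × Fin 2 → M → ℂ, ∀ a y, c a y = comp g e y (Z y) a.1 a.2 :=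
    ⟨_, fun _ _ => rfl⟩
  obtain ⟨b, hb⟩ : ∃ b : Fin 2 × Fin 2 → CField M, ∀ a, b a = e a.1 a.2 := ⟨_, fun _ => rfl⟩
  have hcs (a : Fin 2 × Fin 2) : ContMDiffOn 𝓘(ℝ, R4) 𝓘(ℝ, ℂ) ∞ (c a) (U ∩ V) :=
    (contMDiffOn_comp heV hZV a.1 a.2).congr fun y _ => hc a y
  have hbs (a : Fin 2 × Fin 2) : SmoothOn (b a) (U ∩ V) := by
    rw [hb]
    exact heV.smooth a.1 a.2
  have hev : ∀ᶠ y in nhds x, Z y = ∑ a, c a y • b a y := by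
    filter_upwards [hUV.mem_nhds ⟨hx, hxV⟩] with y hy
    rw [Fintype.sum_prod_type]
    simp only [hc, hb]
    exact eq_sum_comp_smul heV hy _
  rw [koszul_congr_right hev, koszul_sum_smul_right Finset.univ hUV ⟨hx, hxV⟩
    (hX.mono Set.inter_subset_left) (hY.mono Set.inter_subset_left) hcs hbs]
  simp only [hc, hb, Fintype.sum_prod_type]

lemma comp_frame (he : IsSpinFrame g e U) (hx : x ∈ U) (A A' B B' : Fin 2) :
    comp g e x (e B B' x) A A' = if A = B ∧ A' = B' then 1 else 0 := by
  simp only [comp, he.inner x hx]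
  fin_cases A <;> fin_cases A' <;> fin_cases B <;> fin_cases B' <;>
    simp [Fin.sum_univ_two, eps]

/-- The Koszul formula holds with the frame vectors in place of the coordinate fields that enter
the definition of the connection, because `koszul g X Y Z` is tensorial in `Z`. -/
lemma form_leviCivita_frame (he : IsSpinFrame g e U) (hx : x ∈ U) (hX : SmoothOn X U)
    (hY : SmoothOn Y U) (B B' : Fin 2) :
    g.form x (leviCivita g X Y x) (e B B' x) = (1 / 2 : ℂ) * koszul g X Y (e B B') x := by
  have hc (i : Fin 4) := koszul_eq_sum_comp he hx hX hY
    (trivializationAt R4 (TangentSpace 𝓘(ℝ, R4) : M → Type) x).open_baseSet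
    (FiberBundle.mem_baseSet_trivializationAt' x) (smoothOn_coordField x i)
  have hf (i : Fin 4) := form_leviCivita_coordBasis (g := g) (X := X) (Y := Y) (x := x) i
  generalize leviCivita g X Y x = w at hf ⊢
  generalize hk : (fun A A' => koszul g X Y (e A A') x) = k
  have hk' (A A' : Fin 2) : koszul g X Y (e A A') x = k A A' := congrFun (congrFun hk A) A'
  simp only [hc, coordField_self, hk'] at hf ⊢
  -- The linear functional that takes the required values on the frame.
  let l : CTangent x →ₗ[ℂ] ℂ :=
    { toFun := fun v => (1 / 2 : ℂ) * ∑ A, ∑ A', comp g e x v A A' * k A A'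
      map_add' := fun v w => by
        simp only [comp_add, add_mul, mul_add, Finset.sum_add_distrib]
      map_smul' := fun z v => by
        simp only [comp_smul, mul_assoc, mul_left_comm _ z, ← Finset.mul_sum, RingHom.id_apply,
          smul_eq_mul] }
  have heq : g.form x w = l := (coordBasis x).ext hf
  rw [heq]
  change (1 / 2 : ℂ) * ∑ A, ∑ A', comp g e x (e B B' x) A A' * k A A' = _
  simp only [comp_frame he hx]
  fin_cases B <;> fin_cases B' <;> simp [Fin.sum_univ_two]

/-- In a spin frame the metric is constant, so that only the bracket terms of the Koszul formula
remain. -/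
lemma koszul_frame (he : IsSpinFrame g e U) (hx : x ∈ U) (A A' B B' C C' : Fin 2) :
    koszul g (e A A') (e B B') (e C C') x =
      g.form x (cLie (e A A') (e B B') x) (e C C' x) -
      g.form x (cLie (e A A') (e C C') x) (e B B' x) -
      g.form x (cLie (e B B') (e C C') x) (e A A' x) := by
  have h (X : CField M) (A A' B B' : Fin 2) :
      cDeriv X (fun y => g.form y (e A A' y) (e B B' y)) x = 0 := by
    rw [cDeriv_congr (h := fun _ => eps A B * eps A' B')]
    · exact cDeriv_const _
    · filter_upwards [he.isOpen.mem_nhds hx] with y hy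
      exact he.inner y hy A A' B B'
  simp [koszul, h]

/-! ### The shear of a spinor field as a Lie bracket -/

variable {φ : M → Fin 2 → ℂ}

lemma smoothOn_spinField (he : IsSpinFrame g e U)
    (hφ : ContMDiffOn 𝓘(ℝ, R4) 𝓘(ℝ, Fin 2 → ℂ) ∞ φ U) (A' : Fin 2) :
    SmoothOn (spinField e φ A') U :=
  SmoothOn.sum fun A _ => SmoothOn.smul (contMDiffOn_pi_space.mp hφ A) (he.smooth A A')

lemma cLie_spinField (he : IsSpinFrame g e U) (hx : x ∈ U)
    (hφ : ContMDiffOn 𝓘(ℝ, R4) 𝓘(ℝ, Fin 2 → ℂ) ∞ φ U) (A' B' : Fin 2) :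
    cLie (spinField e φ A') (spinField e φ B') x =
      ∑ A, ∑ B, ((φ x A * φ x B) • cLie (e A A') (e B B') x +
        (φ x A * cDeriv (e A A') (fun y => φ y B) x) • e B B' x -
        (φ x B * cDeriv (e B B') (fun y => φ y A) x) • e A A' x) := by
  have hs (A A' : Fin 2) : DiffAt (fun y => φ y A • e A A' y) x :=
    (SmoothOn.smul (contMDiffOn_pi_space.mp hφ A) (he.smooth A A')).diffAt he.isOpen hx
  have hf (A : Fin 2) : MDifferentiableAt 𝓘(ℝ, R4) 𝓘(ℝ, ℂ) (fun y => φ y A) x :=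
    ((contMDiffOn_pi_space.mp hφ A).contMDiffAt (he.isOpen.mem_nhds hx)).mdifferentiableAt
      (by simp)
  have hd (A A' : Fin 2) : DiffAt (e A A') x := (he.smooth A A').diffAt he.isOpen hx
  have hAB (A B : Fin 2) : cLie (fun y => φ y A • e A A' y) (fun y => φ y B • e B B' y) x =
      (φ x A * φ x B) • cLie (e A A') (e B B') x +
        (φ x A * cDeriv (e A A') (fun y => φ y B) x) • e B B' x -
        (φ x B * cDeriv (e B B') (fun y => φ y A) x) • e A A' x := by
    rw [cLie_smul_left (hf A) (hd A A'), cLie_smul_right (hf B) (hd B B')]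
    simp only [cDeriv_eq_cDerivL, map_smul, smul_eq_mul]
    module
  unfold spinField
  simp only [Fin.sum_univ_two, ← hAB]
  rw [cLie_add_left (hs 0 A') (hs 1 A'), cLie_add_right (hs 0 B') (hs 1 B'),
    cLie_add_right (hs 0 B') (hs 1 B')]

/-- The polynomial identity behind `shear_eq_neg_form_cLie`: `p`, `d` and `c` stand for the
components of a spinor, its derivatives along the frame, and the structure functions of the
frame. -/
lemma shear_identity (p : Fin 2 → ℂ) (d : Fin 2 → Fin 2 → Fin 2 → ℂ)
    (c : Fin 2 → Fin 2 → Fin 2 → Fin 2 → Fin 2 → Fin 2 → ℂ)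
    (hc : ∀ A A' B B' C C', c A A' B B' C C' = -c B B' A A' C C') (A' : Fin 2) :
    ∑ A, ∑ B, p A * p B * (∑ C, (d A A' C + ∑ D, ((1 / 2 : ℂ) * ∑ B', ∑ E, ∑ E',
        eps C E * eps B' E' * ((1 / 2 : ℂ) *
          (c A A' D B' E E' - c A A' E E' D B' - c D B' E E' A A'))) * p D) * eps C B) =
      -∑ C, p C * ∑ A, ∑ B, (p A * p B * c A 0 B 1 C A' +
        p A * d A 0 B * (eps B C * eps 1 A') - p B * d B 1 A * (eps A C * eps 0 A')) := by
  have hd (A A' C C' : Fin 2) : c A A' A A' C C' = 0 := self_eq_neg.mp (hc A A' A A' C C')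
  have h1 := hc 0 1 0 0
  have h2 := hc 1 0 0 0
  have h3 := hc 1 1 0 0
  have h4 := hc 1 0 0 1
  have h5 := hc 1 1 0 1
  have h6 := hc 1 1 1 0
  fin_cases A' <;>
  · simp only [Fin.sum_univ_two, eps, Fin.zero_eta, Fin.mk_one, Matrix.of_apply,
      Matrix.cons_val', Matrix.cons_val_zero, Matrix.cons_val_one, Matrix.cons_val_fin_one,
      hd, h1, h2, h3, h4, h5, h6]
    ring

/-- The shear of `φ^A` is a component of the Lie bracket of the vector fields `φ^A e_{AA'}`. -/
lemma shear_eq_neg_form_cLie (he : IsSpinFrame g e U) (hx : x ∈ U)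
    (hφ : ContMDiffOn 𝓘(ℝ, R4) 𝓘(ℝ, Fin 2 → ℂ) ∞ φ U) (A' : Fin 2) :
    ∑ A, ∑ B, φ x A * φ x B * (∑ C, spinDeriv g e φ A A' C x * eps C B) =
      -g.form x (cLie (spinField e φ 0) (spinField e φ 1) x) (spinField e φ A' x) := by
  rw [cLie_spinField he hx hφ]
  simp only [spinField, map_sum, map_smul, LinearMap.sum_apply, LinearMap.add_apply,
    LinearMap.sub_apply, LinearMap.smul_apply, map_add, map_sub, smul_eq_mul, he.inner x hx,
    spinDeriv, spinCoeff, comp,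
    form_leviCivita_frame he hx (he.smooth _ _) (he.smooth _ _), koszul_frame he hx]
  exact shear_identity (φ x) (fun A A' B => cDeriv (e A A') (fun y => φ y B) x)
    (fun A A' B B' C C' => g.form x (cLie (e A A') (e B B') x) (e C C' x))
    (fun A A' B B' C C' => by rw [cLie_swap, map_neg, LinearMap.neg_apply]) A'

lemma exists_eq_spinVec_iff_comp (he : IsSpinFrame g e U) (hx : x ∈ U) {p : Fin 2 → ℂ}
    (hp : p ≠ 0) (v : CTangent x) : (∃ ν, v = spinVec e x p ν) ↔
      ∀ A', comp g e x v 0 A' * p 1 = comp g e x v 1 A' * p 0 := by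
  constructor
  · rintro ⟨ν, rfl⟩ A'
    simp only [comp_spinVec he hx]
    ring
  · intro h
    have key (A : Fin 2) (hA : p A ≠ 0) : v = spinVec e x p fun A' => comp g e x v A A' / p A := by
      conv_lhs => rw [eq_sum_comp_smul he hx v]
      unfold spinVec
      refine Finset.sum_congr rfl fun B _ => Finset.sum_congr rfl fun B' _ => ?_
      congr 1
      have := h B'
      rw [← mul_div_assoc, eq_div_iff hA]
      fin_cases A <;> fin_cases B <;> simp only [Fin.zero_eta, Fin.mk_one]
      · ring
      · linear_combination -this
      · linear_combination this
      · ring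
    by_cases h0 : p 0 = 0
    · exact ⟨_, key 1 fun h1 => hp (by ext A; fin_cases A <;> simp [h0, h1])⟩
    · exact ⟨_, key 0 h0⟩

/-- The null plane `φ^A ν^{A'}` is its own orthogonal complement. -/
lemma exists_eq_spinVec_iff_form (he : IsSpinFrame g e U) (hx : x ∈ U) (hp : φ x ≠ 0)
    (v : CTangent x) : (∃ ν, v = spinVec e x (φ x) ν) ↔
      ∀ A', g.form x v (spinField e φ A' x) = 0 := by
  rw [exists_eq_spinVec_iff_comp he hx hp]
  simp only [comp, spinField, Fin.forall_fin_two, Fin.sum_univ_two, eps, map_add, map_smul]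
  simp
  constructor
  · rintro ⟨h0, h1⟩
    constructor
    · linear_combination -h1
    · linear_combination h0
  · rintro ⟨h0, h1⟩
    constructor
    · linear_combination h1
    · linear_combination -h0

/-- A spinor field is shear-free if and only if the null planes `φ^A ν^{A'}` contain the bracket
of the two vector fields `φ^A e_{AA'}` that span them. -/
lemma shearFreeOn_iff_cLie (he : IsSpinFrame g e U)
    (hφ : ContMDiffOn 𝓘(ℝ, R4) 𝓘(ℝ, Fin 2 → ℂ) ∞ φ U) (h0 : ∀ x ∈ U, φ x ≠ 0) :
    ShearFreeOn g e φ U ↔ ∀ x ∈ U, ∃ ν,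
      cLie (spinField e φ 0) (spinField e φ 1) x = spinVec e x (φ x) ν := by
  refine forall₂_congr fun x hx => ?_
  rw [exists_eq_spinVec_iff_form he hx (h0 x hx)]
  simp only [shear_eq_neg_form_cLie he hx hφ, neg_eq_zero]

end Frames

section Spinors

variable {M : Type*} [TopologicalSpace M] [ChartedSpace R4 M]

/-! ### Spinor components -/

lemma spinVec_smul_left (e : Fin 2 → Fin 2 → CField M) (x : M) (z : ℂ) (φ ν : Fin 2 → ℂ) :
    spinVec e x (z • φ) ν = spinVec e x φ (z • ν) := by
  simp only [spinVec, Pi.smul_apply, smul_eq_mul, mul_left_comm, mul_assoc]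

lemma spinVec_add_left (e : Fin 2 → Fin 2 → CField M) (x : M) (φ ψ ν : Fin 2 → ℂ) :
    spinVec e x (φ + ψ) ν = spinVec e x φ ν + spinVec e x ψ ν := by
  simp only [spinVec, Pi.add_apply, add_mul, add_smul, Finset.sum_add_distrib]

lemma spinVec_single (e : Fin 2 → Fin 2 → CField M) (x : M) (φ : Fin 2 → ℂ) (A' : Fin 2) :
    spinVec e x φ (Pi.single A' 1) = ∑ A, φ A • e A A' x := by
  fin_cases A' <;> simp [spinVec]

lemma mem_span_singleton_iff_mul_eq {φ : Fin 2 → ℂ} (hφ : φ ≠ 0) (ψ : Fin 2 → ℂ) :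
    ψ ∈ Submodule.span ℂ {φ} ↔ φ 0 * ψ 1 = φ 1 * ψ 0 := by
  rw [Submodule.mem_span_singleton]
  constructor
  · rintro ⟨z, rfl⟩
    simp only [Pi.smul_apply, smul_eq_mul]
    ring
  · intro h
    by_cases h0 : φ 0 = 0
    · have h1 : φ 1 ≠ 0 := fun h1 => hφ (by ext A; fin_cases A <;> simp [h0, h1])
      refine ⟨ψ 1 / φ 1, ?_⟩
      ext A
      fin_cases A
      · have : ψ 0 = 0 := by simpa [h0, h1] using h.symm
        simp [h0, this]
      · simp [h1]
    · refine ⟨ψ 0 / φ 0, ?_⟩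
      ext A
      fin_cases A
      · simp [h0]
      · simp only [Fin.mk_one, Pi.smul_apply, smul_eq_mul]
        field_simp
        linear_combination -h

variable [IsManifold 𝓘(ℝ, R4) ∞ M]

/-! ### Shear-free spinor fields and involutive distributions -/

section

variable {g : CMetric M} {e : Fin 2 → Fin 2 → CField M} {U : Set M} {x : M}
  {φ : M → Fin 2 → ℂ}

/-- Local sections of the null planes `φ^A ν^{A'}` have smooth coefficients with respect to the
fields `φ^A e_{AA'}`. -/
lemma exists_eq_sum_spinField (he : IsSpinFrame g e U)
    (hφ : ContMDiffOn 𝓘(ℝ, R4) 𝓘(ℝ, Fin 2 → ℂ) ∞ φ U) (h0 : ∀ x ∈ U, φ x ≠ 0) {X : CField M}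
    (hX : SmoothOn X U) (hXφ : ∀ x ∈ U, ∃ ν, X x = spinVec e x (φ x) ν) (hx : x ∈ U) :
    ∃ W ⊆ U, IsOpen W ∧ x ∈ W ∧ ∃ a : Fin 2 → M → ℂ,
      (∀ A', ContMDiffOn 𝓘(ℝ, R4) 𝓘(ℝ, ℂ) ∞ (a A') W) ∧
      ∀ y ∈ W, X y = ∑ A', a A' y • spinField e φ A' y := by
  obtain ⟨A, hA⟩ := Function.ne_iff.mp (h0 x hx)
  have hφA := contMDiffOn_pi_space.mp hφ A
  refine ⟨U ∩ (fun y => φ y A) ⁻¹' {0}ᶜ, Set.inter_subset_left,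
    hφA.continuousOn.isOpen_inter_preimage he.isOpen isOpen_compl_singleton, ⟨hx, hA⟩,
    fun A' y => comp g e y (X y) A A' * (φ y A)⁻¹, fun A' => ?_, ?_⟩
  · exact contMDiffOn_mul ((contMDiffOn_comp he hX A A').mono Set.inter_subset_left)
      (contMDiffOn_inv (hφA.mono Set.inter_subset_left) fun y hy => hy.2)
  · rintro y ⟨hy, hyA⟩
    obtain ⟨ν, hν⟩ := hXφ y hy
    have hyA' : φ y A ≠ 0 := hyA
    simp only [hν, comp_spinVec he hy]
    rw [spinVec_eq_sum_spinField]
    refine Finset.sum_congr rfl fun A' _ => ?_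
    congr 1
    field_simp

/-- If `V 0`, `V 1` and their bracket lie in `L` at `x`, so does, by the Leibniz rule, the bracket
of any two combinations of `V 0` and `V 1` with smooth coefficients. -/
lemma cLie_sum_smul_mem {L : Submodule ℂ (CTangent x)} (hU : IsOpen U) (hx : x ∈ U)
    {V : Fin 2 → CField M} (hV : ∀ i, SmoothOn (V i) U) (hVL : ∀ i, V i x ∈ L)
    (hL : cLie (V 0) (V 1) x ∈ L) {a b : Fin 2 → M → ℂ}
    (ha : ∀ i, ContMDiffOn 𝓘(ℝ, R4) 𝓘(ℝ, ℂ) ∞ (a i) U)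
    (hb : ∀ i, ContMDiffOn 𝓘(ℝ, R4) 𝓘(ℝ, ℂ) ∞ (b i) U) :
    cLie (fun y => ∑ i, a i y • V i y) (fun y => ∑ i, b i y • V i y) x ∈ L := by
  have hself (i : Fin 2) : cLie (V i) (V i) x = 0 := by
    apply CTangent.ext
    · simp [rePart_cLie]
    · rw [imPart_cLie, VectorField.mlieBracket_swap_apply]
      simp
  have hLij (i j : Fin 2) : cLie (V i) (V j) x ∈ L := by
    fin_cases i <;> fin_cases j <;> simp only [Fin.zero_eta, Fin.mk_one, hself, L.zero_mem, hL]
    rw [cLie_swap]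
    exact L.neg_mem hL
  have hd {f : M → ℂ} (hf : ContMDiffOn 𝓘(ℝ, R4) 𝓘(ℝ, ℂ) ∞ f U) :
      MDifferentiableAt 𝓘(ℝ, R4) 𝓘(ℝ, ℂ) f x :=
    (hf.contMDiffAt (hU.mem_nhds hx)).mdifferentiableAt (by simp)
  have hs {f : M → ℂ} (hf : ContMDiffOn 𝓘(ℝ, R4) 𝓘(ℝ, ℂ) ∞ f U) (i : Fin 2) :
      DiffAt (fun y => f y • V i y) x := (SmoothOn.smul hf (hV i)).diffAt hU hx
  have hij (i j : Fin 2) : cLie (fun y => a i y • V i y) (fun y => b j y • V j y) x ∈ L := by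
    rw [cLie_smul_left (hd (ha i)) ((hV i).diffAt hU hx),
      cLie_smul_right (hd (hb j)) ((hV j).diffAt hU hx)]
    exact L.add_mem (L.neg_mem (L.smul_mem _ (hVL i)))
      (L.smul_mem _ (L.add_mem (L.smul_mem _ (hVL j)) (L.smul_mem _ (hLij i j))))
  simp only [Fin.sum_univ_two]
  rw [cLie_add_left (hs (ha 0) 0) (hs (ha 1) 1), cLie_add_right (hs (hb 0) 0) (hs (hb 1) 1),
    cLie_add_right (hs (hb 0) 0) (hs (hb 1) 1)]
  exact L.add_mem (L.add_mem (hij 0 0) (hij 0 1)) (L.add_mem (hij 1 0) (hij 1 1))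

end

/-- A projective spinor field is shear-free if and only if the distribution of null planes
`φ^A ν^{A'}` is involutive. -/
theorem ProjSpinorField.shearFree_iff_involutive {g : CMetric M} {ι : Type*}
    {S : SpinStructure g ι} (ℓ : ProjSpinorField S) {L : ∀ x : M, Submodule ℂ (CTangent x)}
    (hL : ∀ i, ∀ x ∈ S.dom i, ∀ v : CTangent x,
      v ∈ L x ↔ ∃ φ ∈ ℓ.line i x, ∃ ν, v = spinVec (S.frame i) x φ ν) :
    ℓ.ShearFree ↔ Involutive L := by
  have hL' {i : ι} {x : M} (hx : x ∈ S.dom i) {p : Fin 2 → ℂ}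
      (hp : ℓ.line i x = Submodule.span ℂ {p}) (v : CTangent x) :
      v ∈ L x ↔ ∃ ν, v = spinVec (S.frame i) x p ν := by
    rw [hL i x hx, hp]
    constructor
    · rintro ⟨ψ, hψ, ν, rfl⟩
      obtain ⟨z, rfl⟩ := Submodule.mem_span_singleton.mp hψ
      exact ⟨z • ν, spinVec_smul_left _ _ _ _ _⟩
    · rintro ⟨ν, rfl⟩
      exact ⟨p, Submodule.mem_span_singleton_self p, ν, rfl⟩
  have hmem {i : ι} {x : M} (hx : x ∈ S.dom i) {φ : M → Fin 2 → ℂ}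
      (hp : ℓ.line i x = Submodule.span ℂ {φ x}) (A' : Fin 2) :
      spinField (S.frame i) φ A' x ∈ L x :=
    (hL' hx hp _).mpr ⟨Pi.single A' 1, (spinVec_single _ _ _ _).symm⟩
  constructor
  · intro hsf U hU X Y hX hY hXL hYL x hx
    obtain ⟨i, hi⟩ := S.cover x
    obtain ⟨V, hVi, hVo, hxV, φ, hφ, hline⟩ := ℓ.locally_spanned i x hi
    have hUV : IsOpen (V ∩ U) := hVo.inter hU
    have he := (S.isSpinFrame i).mono hVo hVi
    have heU := he.mono hUV Set.inter_subset_left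
    have hφU := hφ.mono (Set.inter_subset_left (t := U))
    have h0 : ∀ y ∈ V ∩ U, φ y ≠ 0 := fun y hy => (hline y hy.1).1
    obtain ⟨W₁, hW₁, hW₁o, hxW₁, a, ha, hXa⟩ := exists_eq_sum_spinField heU hφU h0
      (hX.mono Set.inter_subset_right)
      (fun y hy => (hL' (hVi hy.1) (hline y hy.1).2 _).mp (hXL y hy.2)) ⟨hxV, hx⟩
    obtain ⟨W₂, hW₂, hW₂o, hxW₂, b, hb, hYb⟩ := exists_eq_sum_spinField heU hφU h0
      (hY.mono Set.inter_subset_right)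
      (fun y hy => (hL' (hVi hy.1) (hline y hy.1).2 _).mp (hYL y hy.2)) ⟨hxV, hx⟩
    rw [cLie_congr (Filter.eventually_of_mem (hW₁o.mem_nhds hxW₁) hXa)
      (Filter.eventually_of_mem (hW₂o.mem_nhds hxW₂) hYb)]
    refine cLie_sum_smul_mem (hW₁o.inter hW₂o) ⟨hxW₁, hxW₂⟩
      (fun A' => (smoothOn_spinField he hφ A').mono fun y hy => (hW₁ hy.1).1)
      (fun A' => hmem hi (hline x hxV).2 A') ?_
      (fun A' => (ha A').mono Set.inter_subset_left)
      (fun A' => (hb A').mono Set.inter_subset_right)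
    exact (hL' hi (hline x hxV).2 _).mpr ((shearFreeOn_iff_cLie he hφ fun y hy =>
      (hline y hy).1).mp (hsf i V hVi hVo φ hφ hline) x hxV)
  · intro hinv i V hVi hVo φ hφ hline
    have he := (S.isSpinFrame i).mono hVo hVi
    rw [shearFreeOn_iff_cLie he hφ fun y hy => (hline y hy).1]
    intro x hx
    exact (hL' (hVi hx) (hline x hx).2 _).mp (hinv V hVo _ _ (smoothOn_spinField he hφ 0)
      (smoothOn_spinField he hφ 1) (fun y hy => hmem (hVi hy) (hline y hy).2 0)
      (fun y hy => hmem (hVi hy) (hline y hy).2 1) x hx)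

/-! ### Integrability and involutive eigenbundles -/

/-- The projections of vector fields to the two eigenbundles are smooth, so it suffices to evaluate
`N_K` on sections of these; it vanishes on pairs from different eigenbundles. -/
lemma AlmostParaHermitian.integrable_iff (H : AlmostParaHermitian M) :
    H.Integrable ↔ Involutive (fun x => Module.End.eigenspace (H.K x) 1) ∧
      Involutive (fun x => Module.End.eigenspace (H.K x) (-1)) := by
  have hKK (x : M) (v : CTangent x) : H.K x (H.K x v) = v :=
    congrArg (fun T : Module.End ℂ (CTangent x) => T v) (H.sq x)
  constructor
  · intro hI
    have key (s : ℂ) (hs : s * s = 1) :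
        Involutive (fun x => Module.End.eigenspace (H.K x) s) := by
      intro U hU X Y hX hY hXs hYs x hx
      have hXs' : ∀ᶠ y in nhds x, H.K y (X y) = s • X y :=
        Filter.eventually_of_mem (hU.mem_nhds hx) fun y hy =>
          Module.End.mem_eigenspace_iff.mp (hXs y hy)
      have hYs' : ∀ᶠ y in nhds x, H.K y (Y y) = s • Y y :=
        Filter.eventually_of_mem (hU.mem_nhds hx) fun y hy =>
          Module.End.mem_eigenspace_iff.mp (hYs y hy)
      have hr (Z : CField M) : cLie Z (fun y => s • Y y) x = s • cLie Z Y x := by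
        rw [cLie_smul_right mdifferentiableAt_const (hY.diffAt hU hx), cDeriv_const]
        simp
      have hl (Z : CField M) : cLie (fun y => s • X y) Z x = s • cLie X Z x := by
        rw [cLie_smul_left mdifferentiableAt_const (hX.diffAt hU hx), cDeriv_const]
        simp
      have hrfl (Z : CField M) : ∀ᶠ y in nhds x, Z y = Z y := .of_forall fun _ => rfl
      have h := hI U hU X Y hX hY x hx
      rw [nijenhuis, cLie_congr hXs' hYs', cLie_congr hXs' (hrfl Y), cLie_congr (hrfl X) hYs',
        hl, hl, hr, hKK, smul_smul, hs, map_add, map_smul] at h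
      have h4 : cLie X Y x = s • H.K x (cLie X Y x) := by
        refine sub_eq_zero.mp (Eq.trans ?_ ((congrArg ((2 : ℂ) • ·) h).trans (smul_zero _)))
        module
      rw [Module.End.mem_eigenspace_iff]
      nth_rewrite 2 [h4]
      rw [smul_smul, hs, one_smul]
    exact ⟨key 1 (by norm_num), key (-1) (by norm_num)⟩
  · rintro ⟨hp, hm⟩ U hU X Y hX hY x hx
    -- the projections of a vector field to the two eigenbundles
    let P (s : ℂ) (Z : CField M) : CField M := fun y => (1 / 2 : ℂ) • Z y + (s / 2) • H.K y (Z y)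
    have hPs (s : ℂ) {Z : CField M} (hZ : SmoothOn Z U) : SmoothOn (P s Z) U :=
      (hZ.const_smul _).add ((H.smooth U hU Z hZ).const_smul _)
    have hPK (s : ℂ) (hs : s * s = 1) (Z : CField M) (y : M) :
        P s Z y ∈ Module.End.eigenspace (H.K y) s := by
      rw [Module.End.mem_eigenspace_iff]
      simp only [P, map_add, map_smul, hKK, smul_add, smul_smul]
      rw [add_comm]
      congr 2
      · ring
      · linear_combination (-1 / 2 : ℂ) * hs
    have hsum (Z : CField M) : Z = fun y => P 1 Z y + P (-1) Z y := by
      funext y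
      simp only [P]
      module
    have hdiff (Z : CField M) : (fun y => H.K y (Z y)) =
        fun y => P 1 Z y + (-1 : ℂ) • P (-1) Z y := by
      funext y
      simp only [P]
      module
    have h1 := Module.End.mem_eigenspace_iff.mp (hp U hU _ _ (hPs 1 hX) (hPs 1 hY)
      (fun y _ => hPK 1 (by norm_num) X y) (fun y _ => hPK 1 (by norm_num) Y y) x hx)
    have h2 := Module.End.mem_eigenspace_iff.mp (hm U hU _ _ (hPs (-1) hX) (hPs (-1) hY)
      (fun y _ => hPK (-1) (by norm_num) X y) (fun y _ => hPK (-1) (by norm_num) Y y) x hx)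
    have hXd (s : ℂ) := (hPs s hX).diffAt hU hx
    have hYd (s : ℂ) := (hPs s hY).diffAt hU hx
    have hXd' := ((hPs (-1) hX).const_smul (-1)).diffAt hU hx
    have hYd' := ((hPs (-1) hY).const_smul (-1)).diffAt hU hx
    have hr (Z : CField M) : cLie Z (fun y => (-1 : ℂ) • P (-1) Y y) x =
        (-1 : ℂ) • cLie Z (P (-1) Y) x := by
      rw [cLie_smul_right mdifferentiableAt_const (hYd (-1)), cDeriv_const]
      simp
    have hl (Z : CField M) : cLie (fun y => (-1 : ℂ) • P (-1) X y) Z x =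
        (-1 : ℂ) • cLie (P (-1) X) Z x := by
      rw [cLie_smul_left mdifferentiableAt_const (hXd (-1)), cDeriv_const]
      simp
    have e1 : cLie X Y x = cLie (P 1 X) (P 1 Y) x + cLie (P 1 X) (P (-1) Y) x +
        (cLie (P (-1) X) (P 1 Y) x + cLie (P (-1) X) (P (-1) Y) x) := by
      conv_lhs => rw [hsum X, hsum Y]
      rw [cLie_add_left (hXd 1) (hXd (-1)), cLie_add_right (hYd 1) (hYd (-1)),
        cLie_add_right (hYd 1) (hYd (-1))]
    have e2 : cLie (fun y => H.K y (X y)) (fun y => H.K y (Y y)) x =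
        cLie (P 1 X) (P 1 Y) x - cLie (P 1 X) (P (-1) Y) x -
        (cLie (P (-1) X) (P 1 Y) x - cLie (P (-1) X) (P (-1) Y) x) := by
      rw [hdiff X, hdiff Y, cLie_add_left (hXd 1) hXd', cLie_add_right (hYd 1) hYd',
        cLie_add_right (hYd 1) hYd', hr, hl, hl, hr]
      module
    have e3 : cLie (fun y => H.K y (X y)) Y x + cLie X (fun y => H.K y (Y y)) x =
        (2 : ℂ) • (cLie (P 1 X) (P 1 Y) x - cLie (P (-1) X) (P (-1) Y) x) := by
      rw [hdiff X, hdiff Y]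
      conv_lhs => enter [1]; rw [hsum Y]
      conv_lhs => enter [2]; rw [hsum X]
      rw [cLie_add_left (hXd 1) hXd', cLie_add_right (hYd 1) (hYd (-1)),
        cLie_add_right (hYd 1) (hYd (-1)), cLie_add_left (hXd 1) (hXd (-1)),
        cLie_add_right (hYd 1) hYd', cLie_add_right (hYd 1) hYd', hl, hl, hr, hr]
      module
    rw [nijenhuis, hKK, e3, e2, e1, map_smul, map_sub, h1, h2]
    module

end Spinors

section Principal

variable {M : Type*} [TopologicalSpace M] [ChartedSpace R4 M] [IsManifold 𝓘(ℝ, R4) ∞ M]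

/-! ### The principal spinor fields of an almost para-Hermitian structure -/

lemma comp_injective {g : CMetric M} {e : Fin 2 → Fin 2 → CField M} {U : Set M} {x : M}
    (he : IsSpinFrame g e U) (hx : x ∈ U) {v w : CTangent x}
    (h : ∀ A A', comp g e x v A A' = comp g e x w A A') : v = w := by
  rw [eq_sum_comp_smul he hx v, eq_sum_comp_smul he hx w]
  simp only [h]

variable {H : AlmostParaHermitian M} {ι : Type*} {S : SpinStructure H.g ι}

/-- In a spin frame, `K^a_b = τ^A_B δ^{A'}_{B'}` with a smooth matrix `τ`. Since `K` is
anti-isometric `det τ = -1`, and then `τ² = 1` makes `τ` trace-free. -/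
lemma NegativeChirality.exists_matrix (hK : NegativeChirality H S) (i : ι) :
    ∃ a b c : M → ℂ, ContMDiffOn 𝓘(ℝ, R4) 𝓘(ℝ, ℂ) ∞ a (S.dom i) ∧
      ContMDiffOn 𝓘(ℝ, R4) 𝓘(ℝ, ℂ) ∞ b (S.dom i) ∧
      ContMDiffOn 𝓘(ℝ, R4) 𝓘(ℝ, ℂ) ∞ c (S.dom i) ∧
      ∀ x ∈ S.dom i, a x * a x + b x * c x = 1 ∧ ∀ φ ν : Fin 2 → ℂ,
        H.K x (spinVec (S.frame i) x φ ν) =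
          spinVec (S.frame i) x ![a x * φ 0 + b x * φ 1, c x * φ 0 - a x * φ 1] ν := by
  have he := S.isSpinFrame i
  have hs (B A : Fin 2) : ContMDiffOn 𝓘(ℝ, R4) 𝓘(ℝ, ℂ) ∞
      (fun x => comp H.g (S.frame i) x (H.K x (S.frame i B 0 x)) A 0) (S.dom i) :=
    contMDiffOn_comp he (H.smooth _ he.isOpen _ (he.smooth B 0)) A 0
  refine ⟨_, _, _, hs 0 0, hs 1 0, hs 0 1, fun x hx => ?_⟩
  obtain ⟨τ, hτ⟩ := hK i x hx
  have hframe (B B' : Fin 2) : S.frame i B B' x =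
      spinVec (S.frame i) x (Pi.single B 1) (Pi.single B' 1) := by
    rw [spinVec_single]
    fin_cases B <;> simp
  have hentry (A B : Fin 2) :
      comp H.g (S.frame i) x (H.K x (S.frame i B 0 x)) A 0 = τ A B := by
    rw [hframe, hτ, comp_spinVec he hx]
    simp
  have hKK (v : CTangent x) : H.K x (H.K x v) = v :=
    congrArg (fun T : Module.End ℂ (CTangent x) => T v) (H.sq x)
  have hsq (A B : Fin 2) : τ A 0 * τ 0 B + τ A 1 * τ 1 B = if A = B then 1 else 0 := by
    have h := congrArg (fun v => comp H.g (S.frame i) x v A 0) (hKK (S.frame i B 0 x))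
    simp only [hframe B 0, hτ, comp_spinVec he hx, Pi.single_eq_same, mul_one] at h
    simpa [Matrix.mulVec, dotProduct, Fin.sum_univ_two, Pi.single_apply] using h
  have hdet : τ 0 0 * τ 1 1 - τ 0 1 * τ 1 0 = -1 := by
    have h := H.skew x (S.frame i 0 0 x) (S.frame i 1 1 x)
    have hKe (B B' : Fin 2) : H.K x (S.frame i B B' x) = ∑ A, τ A B • S.frame i A B' x := by
      rw [hframe, hτ, spinVec_single]
      fin_cases B <;> simp [Matrix.mulVec, dotProduct]
    rw [hKe, hKe] at h
    simp only [Fin.sum_univ_two, map_add, map_smul, LinearMap.add_apply, LinearMap.smul_apply,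
      smul_eq_mul, he.inner x hx, eps] at h
    simp at h
    linear_combination h
  -- `(tr τ)² = tr (τ²) + 2 det τ = 0`
  have h00 := hsq 0 0
  have h11 := hsq 1 1
  simp only [if_true] at h00 h11
  have htr : τ 1 1 = -τ 0 0 := by
    have : (τ 0 0 + τ 1 1) ^ 2 = 0 := by linear_combination h00 + h11 + 2 * hdet
    linear_combination pow_eq_zero_iff (two_ne_zero) |>.mp this
  simp only [hentry]
  refine ⟨h00, fun φ ν => ?_⟩
  rw [hτ]
  congr 1
  ext A
  fin_cases A
  · simp [Matrix.mulVec, dotProduct, Fin.sum_univ_two]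
  · simp [Matrix.mulVec, dotProduct, Fin.sum_univ_two, htr]
    ring

/-- The spinors `φ^A` for which all vectors `φ^A ν^{A'}` lie in the eigenspace of `K` for `s`. -/
def eigenLine (S : SpinStructure H.g ι) (s : ℂ) (i : ι) (x : M) : Submodule ℂ (Fin 2 → ℂ) where
  carrier := {φ | ∀ ν, spinVec (S.frame i) x φ ν ∈ Module.End.eigenspace (H.K x) s}
  add_mem' hφ hψ ν := by
    rw [spinVec_add_left]
    exact Submodule.add_mem _ (hφ ν) (hψ ν)
  zero_mem' ν := by
    simp [spinVec]
  smul_mem' z φ hφ ν := by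
    rw [spinVec_smul_left]
    exact hφ _

lemma mem_eigenLine_iff {s : ℂ} {i : ι} {x : M} (hx : x ∈ S.dom i) {T : (Fin 2 → ℂ) → Fin 2 → ℂ}
    (hT : ∀ φ ν : Fin 2 → ℂ,
      H.K x (spinVec (S.frame i) x φ ν) = spinVec (S.frame i) x (T φ) ν) (φ : Fin 2 → ℂ) :
    φ ∈ eigenLine S s i x ↔ T φ = s • φ := by
  have he := S.isSpinFrame i
  constructor
  · intro h
    have h1 := Module.End.mem_eigenspace_iff.mp (h (Pi.single 0 1))
    rw [hT] at h1
    ext A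
    have := congrArg (fun v => comp H.g (S.frame i) x v A 0) h1
    simpa [comp_smul, comp_spinVec he hx] using this
  · intro h ν
    rw [Module.End.mem_eigenspace_iff, hT, h]
    apply comp_injective he hx
    intro A A'
    simp only [comp_smul, comp_spinVec he hx, Pi.smul_apply, smul_eq_mul, mul_assoc]

/-- The columns of `τ + s` are local representatives of the eigenline of `τ` for `s`: they lie in
it because `(τ - s) (τ + s) = 0`, and they do not both vanish because `τ ≠ -s`. -/
lemma eigenLine_locally_spanned (hK : NegativeChirality H S) {s : ℂ} (hs : s * s = 1) (i : ι)
    {p : M} (hp : p ∈ S.dom i) : ∃ V ⊆ S.dom i, IsOpen V ∧ p ∈ V ∧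
      ∃ φ : M → Fin 2 → ℂ, ContMDiffOn 𝓘(ℝ, R4) 𝓘(ℝ, Fin 2 → ℂ) ∞ φ V ∧
        ∀ x ∈ V, φ x ≠ 0 ∧ eigenLine S s i x = Submodule.span ℂ {φ x} := by
  obtain ⟨a, b, c, ha, hb, hc, h⟩ := hK.exists_matrix i
  have hs0 : s ≠ 0 := by
    rintro rfl
    simp at hs
  have hline {x : M} (hx : x ∈ S.dom i) (ψ : Fin 2 → ℂ) : ψ ∈ eigenLine S s i x ↔
      a x * ψ 0 + b x * ψ 1 = s * ψ 0 ∧ c x * ψ 0 - a x * ψ 1 = s * ψ 1 := by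
    rw [mem_eigenLine_iff hx (h x hx).2, funext_iff, Fin.forall_fin_two]
    simp
  -- Either column can be used wherever it does not vanish.
  have key (φ : M → Fin 2 → ℂ) (hφ : ContMDiffOn 𝓘(ℝ, R4) 𝓘(ℝ, Fin 2 → ℂ) ∞ φ (S.dom i))
      (hφp : φ p ≠ 0)
      (hmem : ∀ x ∈ S.dom i, φ x ∈ eigenLine S s i x)
      (hpar : ∀ x ∈ S.dom i, ∀ ψ ∈ eigenLine S s i x, φ x 0 * ψ 1 = φ x 1 * ψ 0) :
      ∃ V ⊆ S.dom i, IsOpen V ∧ p ∈ V ∧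
      ∃ φ : M → Fin 2 → ℂ, ContMDiffOn 𝓘(ℝ, R4) 𝓘(ℝ, Fin 2 → ℂ) ∞ φ V ∧
        ∀ x ∈ V, φ x ≠ 0 ∧ eigenLine S s i x = Submodule.span ℂ {φ x} := by
    refine ⟨S.dom i ∩ φ ⁻¹' {0}ᶜ, Set.inter_subset_left,
      hφ.continuousOn.isOpen_inter_preimage (S.isOpen i) isOpen_compl_singleton, ⟨hp, hφp⟩, φ,
      hφ.mono Set.inter_subset_left, ?_⟩
    rintro x ⟨hx, hx0⟩
    refine ⟨hx0, le_antisymm (fun ψ hψ => ?_) ?_⟩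
    · exact (mem_span_singleton_iff_mul_eq hx0 ψ).mpr (hpar x hx ψ hψ)
    · rw [Submodule.span_singleton_le_iff_mem]
      exact hmem x hx
  have hadd {f : M → ℂ} (hf : ContMDiffOn 𝓘(ℝ, R4) 𝓘(ℝ, ℂ) ∞ f (S.dom i)) :
      ContMDiffOn 𝓘(ℝ, R4) 𝓘(ℝ, ℂ) ∞ (fun x => f x + s) (S.dom i) := hf.add contMDiffOn_const
  by_cases h0 : (![a p + s, c p] : Fin 2 → ℂ) = 0
  · have hap : a p + s = 0 := congrFun h0 0
    refine key (fun x => ![b x, s - a x]) ?_ ?_ ?_ ?_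
    · rw [contMDiffOn_pi_space, Fin.forall_fin_two]
      exact ⟨hb, contMDiffOn_const.sub ha⟩
    · intro h1
      have h2 : s - a p = 0 := congrFun h1 1
      exact hs0 (by linear_combination (1 / 2 : ℂ) * (hap + h2))
    · intro x hx
      rw [hline hx]
      simp only [Matrix.cons_val_zero, Matrix.cons_val_one, Matrix.cons_val_fin_one]
      have := (h x hx).1
      constructor
      · ring
      · linear_combination this - hs
    · intro x hx ψ hψ
      rw [hline hx] at hψ
      simp only [Matrix.cons_val_zero, Matrix.cons_val_one, Matrix.cons_val_fin_one]
      linear_combination hψ.1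
  · refine key (fun x => ![a x + s, c x]) ?_ h0 ?_ ?_
    · rw [contMDiffOn_pi_space, Fin.forall_fin_two]
      exact ⟨hadd ha, hc⟩
    · intro x hx
      rw [hline hx]
      simp only [Matrix.cons_val_zero, Matrix.cons_val_one, Matrix.cons_val_fin_one]
      have := (h x hx).1
      constructor
      · linear_combination this - hs
      · ring
    · intro x hx ψ hψ
      rw [hline hx] at hψ
      simp only [Matrix.cons_val_zero, Matrix.cons_val_one, Matrix.cons_val_fin_one]
      linear_combination -hψ.2

/-- The projective spinor field that represents `K` through its eigenbundle for `s = ±1`. -/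
def eigenSpinorField (hK : NegativeChirality H S) {s : ℂ} (hs : s * s = 1) :
    ProjSpinorField S where
  line := eigenLine S s
  locally_spanned i _ hp := eigenLine_locally_spanned hK hs i hp
  compat i j x _ _ Λ Λ' h := by
    ext φ
    rw [Submodule.mem_map]
    constructor
    · intro hφ
      refine ⟨(Λ⁻¹).1.mulVec φ, fun ν => ?_, ?_⟩
      · rw [h, Matrix.mulVec_mulVec, ← Matrix.SpecialLinearGroup.coe_mul, mul_inv_cancel,
          Matrix.SpecialLinearGroup.coe_one, Matrix.one_mulVec]
        exact hφ _
      · rw [Matrix.mulVecLin_apply, Matrix.mulVec_mulVec, ← Matrix.SpecialLinearGroup.coe_mul,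
          mul_inv_cancel, Matrix.SpecialLinearGroup.coe_one, Matrix.one_mulVec]
    · rintro ⟨ψ, hψ, rfl⟩ ν
      have h1 := hψ ((Λ'⁻¹).1.mulVec ν)
      rwa [h, Matrix.mulVec_mulVec, ← Matrix.SpecialLinearGroup.coe_mul, mul_inv_cancel,
        Matrix.SpecialLinearGroup.coe_one, Matrix.one_mulVec] at h1

lemma mem_eigenspace_iff_exists_eigenLine (hK : NegativeChirality H S) {s : ℂ} (hs : s * s = 1)
    (i : ι) {x : M} (hx : x ∈ S.dom i) (v : CTangent x) :
    v ∈ Module.End.eigenspace (H.K x) s ↔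
      ∃ φ ∈ eigenLine S s i x, ∃ ν : Fin 2 → ℂ, v = spinVec (S.frame i) x φ ν := by
  have he := S.isSpinFrame i
  constructor
  · intro hv
    obtain ⟨V, hV, -, hxV, φ, -, hφ⟩ := eigenLine_locally_spanned hK hs i hx
    obtain ⟨h0, hline⟩ := hφ x hxV
    refine ⟨φ x, hline ▸ Submodule.mem_span_singleton_self _, ?_⟩
    rw [exists_eq_spinVec_iff_comp he hx h0]
    intro A'
    obtain ⟨a, b, c, -, -, -, h⟩ := hK.exists_matrix i
    have hT := (h x hx).2
    have hcol : v = ∑ B', spinVec (S.frame i) x (fun A => comp H.g (S.frame i) x v A B')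
        (Pi.single B' 1) := by
      simp only [spinVec_single]
      rw [Finset.sum_comm]
      exact eq_sum_comp_smul he hx v
    have hcomp_add (v w : CTangent x) (A A' : Fin 2) :=
      comp_add (g := H.g) (e := S.frame i) v w A A'
    have hmem : (fun A => comp H.g (S.frame i) x v A A') ∈ eigenLine S s i x := by
      rw [mem_eigenLine_iff hx hT]
      have hKv := Module.End.mem_eigenspace_iff.mp hv
      have hKc : H.K x v = ∑ B', spinVec (S.frame i) x
          ![a x * comp H.g (S.frame i) x v 0 B' + b x * comp H.g (S.frame i) x v 1 B',
            c x * comp H.g (S.frame i) x v 0 B' - a x * comp H.g (S.frame i) x v 1 B']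
          (Pi.single B' 1) := by
        conv_lhs => rw [hcol, map_sum]
        simp only [hT]
      ext A
      have h1 := congrArg (fun w => comp H.g (S.frame i) x w A A') hKv
      simp only [comp_smul] at h1
      rw [Pi.smul_apply, smul_eq_mul, ← h1, hKc]
      simp only [Fin.sum_univ_two, hcomp_add, comp_spinVec he hx]
      fin_cases A' <;> simp
    rw [hline, mem_span_singleton_iff_mul_eq h0] at hmem
    linear_combination -hmem
  · rintro ⟨φ, hφ, ν, rfl⟩
    exact hφ ν

/-- If the same eigenbundle of `K` consists of the null planes of both `φ` and `ψ`, then the two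
projective spinor fields agree, so that they are nowhere linearly independent. -/
lemma not_disjoint_line_of_eigenspace {φ ψ : ProjSpinorField S} {s : ℂ} {i : ι} {x : M}
    (hx : x ∈ S.dom i)
    (hφ : ∀ v : CTangent x, v ∈ Module.End.eigenspace (H.K x) s ↔
      ∃ p ∈ φ.line i x, ∃ ν : Fin 2 → ℂ, v = spinVec (S.frame i) x p ν)
    (hψ : ∀ v : CTangent x, v ∈ Module.End.eigenspace (H.K x) s ↔
      ∃ p ∈ ψ.line i x, ∃ ν : Fin 2 → ℂ, v = spinVec (S.frame i) x p ν) :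
    ¬Disjoint (φ.line i x) (ψ.line i x) := by
  have he := S.isSpinFrame i
  obtain ⟨V, -, -, hxV, p, -, hp⟩ := φ.locally_spanned i x hx
  obtain ⟨h0, hline⟩ := hp x hxV
  have hpφ : p x ∈ φ.line i x := hline ▸ Submodule.mem_span_singleton_self _
  obtain ⟨q, hq, ν, hqν⟩ := (hψ _).mp ((hφ _).mpr ⟨p x, hpφ, Pi.single 0 1, rfl⟩)
  have hpq : p x = ν 0 • q := by
    ext A
    have := congrArg (fun v => comp H.g (S.frame i) x v A 0) hqν
    simp only [comp_spinVec he hx, Pi.single_eq_same, mul_one] at this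
    rw [this, Pi.smul_apply, smul_eq_mul, mul_comm]
  intro hd
  exact h0 (Submodule.disjoint_def.mp hd _ hpφ (hpq ▸ Submodule.smul_mem _ _ hq))

end Principal

end ParaHermitian

end

theorem mainTheorem4 {M : Type*} [TopologicalSpace M] [ChartedSpace ParaHermitian.R4 M]
    [IsManifold 𝓘(ℝ, ParaHermitian.R4) ∞ M]
    (H : ParaHermitian.AlmostParaHermitian M) {ι : Type*}
    (S : ParaHermitian.SpinStructure H.g ι) (hK : ParaHermitian.NegativeChirality H S) :
    (H.HalfIntegrable ↔
      ∃ φ : ParaHermitian.ProjSpinorField S, φ.Represents ∧ φ.ShearFree) ∧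
    (H.Integrable ↔
      ∃ φ ψ : ParaHermitian.ProjSpinorField S,
        φ.Represents ∧ ψ.Represents ∧ φ.LinIndep ψ ∧ φ.ShearFree ∧ ψ.ShearFree) := by
  have h1 : (1 : ℂ) * 1 = 1 := by norm_num
  have h2 : (-1 : ℂ) * (-1) = 1 := by norm_num
  have hmem {s : ℂ} (hs : s * s = 1) := fun i x (hx : x ∈ S.dom i) =>
    ParaHermitian.mem_eigenspace_iff_exists_eigenLine hK hs i hx
  have hshear {s : ℂ} (hs : s * s = 1)
      (hinv : ParaHermitian.Involutive (fun x => Module.End.eigenspace (H.K x) s)) :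
      (ParaHermitian.eigenSpinorField hK hs).ShearFree :=
    ((ParaHermitian.eigenSpinorField hK hs).shearFree_iff_involutive (hmem hs)).mpr hinv
  constructor
  · constructor
    · rintro (hinv | hinv)
      · exact ⟨ParaHermitian.eigenSpinorField hK h1, ⟨1, Or.inl rfl, hmem h1⟩, hshear h1 hinv⟩
      · exact ⟨ParaHermitian.eigenSpinorField hK h2, ⟨-1, Or.inr rfl, hmem h2⟩, hshear h2 hinv⟩
    · rintro ⟨φ, ⟨s, hs, hφ⟩, hsf⟩
      have hinv := (φ.shearFree_iff_involutive hφ).mp hsf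
      rcases hs with rfl | rfl
      · exact Or.inl hinv
      · exact Or.inr hinv
  · rw [H.integrable_iff]
    constructor
    · rintro ⟨hp, hm⟩
      refine ⟨ParaHermitian.eigenSpinorField hK h1, ParaHermitian.eigenSpinorField hK h2,
        ⟨1, Or.inl rfl, hmem h1⟩, ⟨-1, Or.inr rfl, hmem h2⟩, fun i x hx => ?_,
        hshear h1 hp, hshear h2 hm⟩
      obtain ⟨a, b, c, -, -, -, h⟩ := hK.exists_matrix i
      refine Submodule.disjoint_def.mpr fun p hp1 hp2 => ?_
      have e1 := (ParaHermitian.mem_eigenLine_iff hx (h x hx).2 p).mp hp1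
      have e2 := (ParaHermitian.mem_eigenLine_iff hx (h x hx).2 p).mp hp2
      rw [e1, one_smul, neg_smul, one_smul] at e2
      exact self_eq_neg.mp e2
    · rintro ⟨φ, ψ, ⟨s, hs, hφ⟩, ⟨t, ht, hψ⟩, hind, hsφ, hsψ⟩
      have iφ := (φ.shearFree_iff_involutive hφ).mp hsφ
      have iψ := (ψ.shearFree_iff_involutive hψ).mp hsψ
      -- On the empty manifold every distribution is involutive; elsewhere `s ≠ t`.
      rcases isEmpty_or_nonempty M with hM | ⟨⟨x⟩⟩
      · exact ⟨fun U _ X Y _ _ _ _ x => (hM.false x).elim,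
          fun U _ X Y _ _ _ _ x => (hM.false x).elim⟩
      obtain ⟨i, hx⟩ := S.cover x
      have hst : s ≠ t := by
        rintro rfl
        exact ParaHermitian.not_disjoint_line_of_eigenspace hx (hφ i x hx) (hψ i x hx)
          (hind i x hx)
      rcases hs with rfl | rfl <;> rcases ht with rfl | rfl
      · exact absurd rfl hst
      · exact ⟨iφ, iψ⟩
      · exact ⟨iψ, iφ⟩
      · exact absurd rfl hst
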